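/- **Setting.** There are $n\ge 1$ replicas. Each transaction $\tau$ is sent at a time $s(\tau)\in\mathbb R$. At each time $t$, replica $i$ has an ordering vote $\sigma_i(t)$, a finite list of distinct transactions. Votes are only ever extended (for $t\le t'$, $\sigma_i(t)$ is an initial segment of $\sigma_i(t')$), and no transaction is in a vote before it is sent. **Streamed ordering graph of $(\sigma_1,\dots,\sigma_n)$.** Let $V$ be the set of transactions that appear in all $n$ votes. The vertices are $V\cup\{\hat v\}$, where $\hat v$ is the "future" vertex. For distinct $a,b\in V$, $w(a,b)$ is the fraction of replicas whose vote has $a$ before $b$. Moreover $w(a,\hat v)=1$, and $w(\hat v,b)=1$ if some transaction that is in some but not all votes precedes $b$ in some vote; otherwise $w(\hat v,b)=0$. Put $$U_{a,b}=\bigl(V\setminus(\{c\ne a: w(c,a)=0\}\cup\{c\neq b: w(c,b)=1\})\bigr)\cup\{\hat v\}.$$ **Streaming Ranked Pairs (one invocation).** The input consists of the votes and an oracle, which gives the decisions "determinate" and "excluded" of the previous invocation (none at the first invocation). A graph $H$ is built, whose edges are marked determinate or indeterminate. 1. Put into $H$, as indeterminate, all edges of weight $1$ between a transaction and $\hat v$,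 in either direction. 2. For $k=n,n-1,\dots,0$, process the edges $(a,b)$ with $a\ne b$ in $V$ and $w(a,b)=k/n$, listed in an arbitrary fixed order, as follows. - First adopt the oracle's decisions on those edges for which it has one. - Then pass repeatedly over the still open edges. When $(a,b)$ is visited, exclude it from $H$ if $H$ restricted to $U_{a,b}$ has a directed path from $b$ to $a$ of determinate edges. Put it into $H$ as determinate if $H$ restricted to $U_{a,b}$ has no directed path from $b$ to $a$ at all (determinate and indeterminate edges allowed). Otherwise defer it. - When no further edge of this weight can be decided, put the deferred ones into $H$ as indeterminate. 3. The output is a topological sort of $V$ along the determinate edges, up to but not including the first transaction that borders an indeterminate edge (other than its edge to $\hat v$). The algorithm is invoked at successive times $T_1\le T_2\le\dots\le T_m$ on the votes at these times, each invocation using the previous one as its oracle. **Theorem.** Let $\Delta$ be such that every transaction sent at a time $t$ is in the votes of all replicas by time $t+\Delta$. Then every transaction $\tau$ is output within time $(n+1)\Delta$ of its sending: for all invocation times $T_1\le\dots\le T_m=T$ with $T\ge s(\tau)+(n+1)\Delta$, the last invocation has an output (the required topological sort exists), and $\tau$ is in its output, whichever topological sort is used. -/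

import Mathlib

namespace StreamingRankedPairs

/-! ### Ordering votes and the streamed ordering graph

`Tx` is the type of transactions.  A profile `σ : Fin n → List Tx` is one ordering vote per replica,
earliest transaction first.  Vertices of the streamed ordering graph are the elements of `Option Tx`:
`some τ` is a transaction and `none` is the "future" vertex. -/

/-- The ordering vote `v` reports `a ≺ b` (both occur, and `a` occurs before `b`). -/
def Precedes {Tx : Type*} (v : List Tx) (a b : Tx) : Prop := List.Sublist [a, b] v

open Classical in
/-- The transactions that appear in the votes of all replicas. -/
noncomputable def common {Tx : Type*} {n : ℕ} (σ : Fin n → List Tx) : Finset Tx :=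
  (Finset.univ.biUnion fun i => (σ i).toFinset).filter fun τ => ∀ i, τ ∈ σ i

open Classical in
/-- The fraction of the replicas that report `a ≺ b`. -/
noncomputable def voteFraction {Tx : Type*} {n : ℕ} (σ : Fin n → List Tx) (a b : Tx) : ℚ :=
  ((Finset.univ.filter fun i => Precedes (σ i) a b).card : ℚ) / n

/-- Some transaction in the votes of some but not all replicas precedes `τ` in some vote. -/
def FuturePrecedes {Tx : Type*} {n : ℕ} (σ : Fin n → List Tx) (τ : Tx) : Prop :=
  ∃ τ', (∃ i, τ' ∈ σ i) ∧ (∃ i, τ' ∉ σ i) ∧ ∃ i, Precedes (σ i) τ' τ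

open Classical in
/-- Edge weights of the streamed ordering graph. -/
noncomputable def weight {Tx : Type*} {n : ℕ} (σ : Fin n → List Tx) :
    Option Tx → Option Tx → ℚ
  | some a, some b => voteFraction σ a b
  | some _, none => 1
  | none, some b => if FuturePrecedes σ b then 1 else 0
  | none, none => 0

/-- `P_τ`: the transactions that precede `τ` in every vote. -/
def preceding {Tx : Type*} {n : ℕ} (σ : Fin n → List Tx) (τ : Tx) : Set Tx :=
  {τ' | τ' ∈ common σ ∧ τ' ≠ τ ∧ voteFraction σ τ' τ = 1}

/-- `R_τ`: the transactions that precede `τ` in no vote. -/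
def subsequent {Tx : Type*} {n : ℕ} (σ : Fin n → List Tx) (τ : Tx) : Set Tx :=
  {τ' | τ' ∈ common σ ∧ τ' ≠ τ ∧ voteFraction σ τ' τ = 0}

/-- `U_{a,b} = (V \ (R_a ∪ P_b)) ∪ {future vertex}`. -/
def neighborhood {Tx : Type*} {n : ℕ} (σ : Fin n → List Tx) (a b : Tx) : Set (Option Tx) :=
  insert none (some '' ((common σ : Set Tx) \ (subsequent σ a ∪ preceding σ b)))

/-! ### The algorithm -/

/-- What the algorithm has decided about an edge: it is in `H` and marked determinate, it is in `H`
and marked indeterminate, or it is left out of `H`. -/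
inductive Decision where
  | determinate
  | indeterminate
  | excluded

/-- The state of a run: the decision on each edge, `none` where no decision was taken (yet). -/
abbrev Decisions (Tx : Type*) := Option Tx × Option Tx → Option Decision

/-- There is a directed path (with at least one edge) from `x` to `y` that stays inside `U` and
consists of edges that satisfy `ok`. -/
def HasPath {Tx : Type*} (U : Set (Option Tx)) (ok : Option Tx × Option Tx → Prop)
    (x y : Option Tx) : Prop :=
  Relation.TransGen (fun u v => u ∈ U ∧ v ∈ U ∧ ok (u, v)) x y

/-- The edge `e` is in `H` and determinate. -/
def IsDet {Tx : Type*} (H : Decisions Tx) (e : Option Tx × Option Tx) : Prop :=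
  H e = some .determinate

/-- The edge `e` is in `H` and indeterminate. -/
def IsIndet {Tx : Type*} (H : Decisions Tx) (e : Option Tx × Option Tx) : Prop :=
  H e = some .indeterminate

/-- The edge of the streamed ordering graph given by a pair of transactions. -/
def toEdge {Tx : Type*} (e : Tx × Tx) : Option Tx × Option Tx := (some e.1, some e.2)

open Classical in
/-- Initially, the edges of weight one between a transaction and the future vertex, in either
direction, are in `H` and indeterminate. -/
noncomputable def initial {Tx : Type*} {n : ℕ} (σ : Fin n → List Tx) : Decisions Tx := fun e =>
  if ∃ τ ∈ common σ, (e = (some τ, none) ∨ e = (none, some τ)) ∧ weight σ e.1 e.2 = 1 then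
    some .indeterminate
  else none

open Classical in
/-- The pairs of distinct transactions whose edge has weight `k / n`. -/
noncomputable def weightClass {Tx : Type*} {n : ℕ} (σ : Fin n → List Tx) (k : ℕ) :
    Finset (Tx × Tx) :=
  (common σ).offDiag.filter fun e => weight σ (some e.1) (some e.2) = (k : ℚ) / n

open Classical in
/-- Adopt the answers of the oracle `O` (the decisions of the previous invocation, without the
indeterminate ones) on the edges in `es`. -/
noncomputable def consultOracle {Tx : Type*} (O : Decisions Tx) (es : List (Tx × Tx))
    (H : Decisions Tx) : Decisions Tx := fun e =>
  if (∃ p ∈ es, e = toEdge p) ∧ (O e = some .determinate ∨ O e = some .excluded) then O e else H e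

open Classical in
/-- Visit the edge `e = (a, b)`.  If it is still open, exclude it if there is a determinate path from
`b` to `a` inside `U_{a,b}`; include it as determinate if there is no path from `b` to `a` inside
`U_{a,b}` at all, indeterminate edges included; otherwise defer it. -/
noncomputable def visit {Tx : Type*} {n : ℕ} (σ : Fin n → List Tx) (H : Decisions Tx)
    (e : Tx × Tx) : Decisions Tx :=
  if H (toEdge e) ≠ none then H
  else if HasPath (neighborhood σ e.1 e.2) (IsDet H) (some e.2) (some e.1) then
    Function.update H (toEdge e) (some .excluded)
  else if ¬ HasPath (neighborhood σ e.1 e.2) (fun f => IsDet H f ∨ IsIndet H f)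
      (some e.2) (some e.1) then
    Function.update H (toEdge e) (some .determinate)
  else H

open Classical in
/-- Mark the edges in `es` that are still open as indeterminate. -/
noncomputable def markRest {Tx : Type*} (es : List (Tx × Tx)) (H : Decisions Tx) :
    Decisions Tx := fun e =>
  if (∃ p ∈ es, e = toEdge p) ∧ H e = none then some .indeterminate else H e

/-- Process the edges of weight `k / n`, listed by `ord`: first adopt the decisions of the oracle,
then pass over the list again and again, where each visit decides an edge or defers it, and mark the
edges that stay deferred as indeterminate.  A pass that decides no edge leaves the state unchanged,
as do all later ones; so as many passes as there are edges exhaust all possible decisions. -/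
noncomputable def processClass {Tx : Type*} {n : ℕ} (ord : Finset (Tx × Tx) → List (Tx × Tx))
    (O : Decisions Tx) (σ : Fin n → List Tx) (H : Decisions Tx) (k : ℕ) : Decisions Tx :=
  let es := ord (weightClass σ k)
  markRest es ((fun H' => es.foldl (visit σ) H')^[es.length] (consultOracle O es H))

/-- One invocation on the votes `σ` with oracle `O`: the weights `k / n` are processed in the order
`k = n, n - 1, …, 0`. -/
noncomputable def invoke {Tx : Type*} {n : ℕ} (ord : Finset (Tx × Tx) → List (Tx × Tx))
    (O : Decisions Tx) (σ : Fin n → List Tx) : Decisions Tx :=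
  (List.range (n + 1)).reverse.foldl (processClass ord O σ) (initial σ)

/-- Successive invocations on the profiles in `history`, earliest first.  The oracle of an invocation
is the result of the one before it; the first invocation has an oracle without answers. -/
noncomputable def runs {Tx : Type*} {n : ℕ} (ord : Finset (Tx × Tx) → List (Tx × Tx))
    (history : List (Fin n → List Tx)) : Decisions Tx :=
  history.foldl (invoke ord) fun _ => none

/-- `τ` borders an indeterminate edge.  The edge from `τ` to the future vertex is not counted: every
transaction has it, and it says only that unseen transactions may come later. -/
def Borders {Tx : Type*} (H : Decisions Tx) (τ : Tx) : Prop :=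
  IsIndet H (none, some τ) ∨
    ∃ τ', IsIndet H (some τ, some τ') ∨ IsIndet H (some τ', some τ)

/-- `L` is a topological sort of the transactions in `V` along the determinate edges of `H`. -/
def IsTopologicalSort {Tx : Type*} (V : Finset Tx) (H : Decisions Tx) (L : List Tx) : Prop :=
  L.Nodup ∧ (∀ τ, τ ∈ L ↔ τ ∈ V) ∧
    ∀ a ∈ V, ∀ b ∈ V, IsDet H (some a, some b) → Precedes L a b

open Classical in
/-- `out` is an output of the invocation on `σ` that follows the invocations on `past`: a topological
sort, up to but not including the first transaction that borders an indeterminate edge. -/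
def IsOutput {Tx : Type*} {n : ℕ} (ord : Finset (Tx × Tx) → List (Tx × Tx))
    (past : List (Fin n → List Tx)) (σ : Fin n → List Tx) (out : List Tx) : Prop :=
  ∃ L, IsTopologicalSort (common σ) (runs ord (past ++ [σ])) L ∧
    out = L.takeWhile fun τ => decide (¬ Borders (runs ord (past ++ [σ])) τ)

/-! ### Sending transactions and voting over time -/

/-- An execution with `n` replicas: when each transaction is sent, and the ordering vote of each
replica at each time. A vote is a finite list without repetitions that is only ever extended, and a
transaction is not voted on before it is sent. -/
structure Execution (n : ℕ) (Tx : Type*) where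
  sent : Tx → ℝ
  vote : ℝ → Fin n → List Tx
  nodup : ∀ t i, (vote t i).Nodup
  extend : ∀ t t' i, t ≤ t' → vote t i <+: vote t' i
  causal : ∀ t i τ, τ ∈ vote t i → sent τ ≤ t

/-- Network delay bound: a transaction sent at time `t` is in all votes by time `t + Δ`. -/
def Execution.DelayBound {n : ℕ} {Tx : Type*} (X : Execution n Tx) (Δ : ℝ) : Prop :=
  ∀ τ i, τ ∈ X.vote (X.sent τ + Δ) i

end StreamingRankedPairs

namespace StreamingRankedPairs

open Relation

variable {Tx : Type*} {n : ℕ}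

/-! ### Lists -/

/-! The core is `path_of_borders`: determinate edges lead from `τ` to every transaction that borders
an indeterminate edge. Every topological sort then places `τ` strictly before all of these, so the
cut falls after `τ`.

Two facts supply such paths. If some vote has `a` before `b`, then `a` was sent at most `Δ` after
`b`; so whatever is sent more than `Δ` after `τ` follows `τ` unanimously, and unanimous edges
between common transactions end up determinate. And if `(a, b)` stays indeterminate, the last
indeterminate edge `(c, d)` on a path from `b` to `a` is heavier or starts at the future vertex, and
determinate edges lead from `d` to `a` (`Deferred`). Tracing these causes upward costs `2 * Δ` per
weight level, so the head of an indeterminate edge of positive weight that lacks `m` votes was sent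
after `T - (2 * m + 1) * Δ` (`sent_gt_of_isIndet`). For a strict majority `2 * m + 1 ≤ n`, and the
head was sent more than `Δ` after `τ`. Otherwise the reverse edge is at least as heavy and not
determinate. If it is indeterminate, its own cause leads to `b`; if it is excluded, a determinate
path leads from `a` to `b`, and the cause of `(a, b)` leads to `a` (`path_to_head`).

A topological sort exists because determinate edges are acyclic, although decisions of different
invocations are mixed. `Insertable` is the invariant that survives adoption by an oracle, since it
quantifies over all later profiles. To prove it, transactions not yet common are contracted to the
future vertex: a path of later edges that would close a cycle becomes a path which already forbade
the acceptance (`Valid.not_reflTransGen`). -/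

theorem precedes_cons {x a b : Tx} {l : List Tx} :
    Precedes (x :: l) a b ↔ Precedes l a b ∨ a = x ∧ b ∈ l := by
  simp [Precedes, List.cons_sublist_cons']

theorem Precedes.mem_left {v : List Tx} {a b : Tx} (h : Precedes v a b) : a ∈ v :=
  h.subset (by simp)

theorem Precedes.mem_right {v : List Tx} {a b : Tx} (h : Precedes v a b) : b ∈ v :=
  h.subset (by simp)

theorem Precedes.mono {v v' : List Tx} {a b : Tx} (h : Precedes v a b) (hv : v <+: v') :
    Precedes v' a b :=
  List.Sublist.trans h hv.sublist

/-- What precedes `b` in a vote is settled as soon as `b` is in it. This is why weights between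
common transactions never change. -/
theorem Precedes.of_extension {v v' : List Tx} {a b : Tx} (h : Precedes v' a b) (hv : v <+: v')
    (hn : v'.Nodup) (hb : b ∈ v) : Precedes v a b := by
  obtain ⟨r, rfl⟩ := hv
  have hbr : b ∉ r := (List.disjoint_of_nodup_append hn) hb
  obtain ⟨l₁, l₂, h₁, h₂, h₃⟩ := List.sublist_append_iff.1 h
  -- A nonempty part of `[a, b]` inside the appended rest would end with `b`.
  rcases List.eq_nil_or_concat l₂ with rfl | ⟨l, x, rfl⟩
  · rw [Precedes, h₁, List.append_nil]
    exact h₂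
  · have : x = b := by
      have := congrArg List.getLast? h₁
      simpa [List.concat_eq_append, ← List.append_assoc] using this.symm
    exact absurd (h₃.subset (by simp [this])) hbr

theorem Precedes.ne {v : List Tx} {a b : Tx} (hn : v.Nodup) (h : Precedes v a b) : a ≠ b := by
  rintro rfl
  simpa [Precedes] using hn.sublist h

theorem Precedes.trans {v : List Tx} {a b c : Tx} (hn : v.Nodup) (h : Precedes v a b)
    (h' : Precedes v b c) : Precedes v a c := by
  induction v with
  | nil => simp [Precedes] at h
  | cons x l ih =>
    rw [List.nodup_cons] at hn
    rw [precedes_cons] at *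
    rcases h with h | ⟨rfl, h⟩
    · rcases h' with h' | ⟨rfl, h'⟩
      · exact Or.inl (ih hn.2 h h')
      · exact absurd h.mem_right hn.1
    · rcases h' with h' | ⟨rfl, h'⟩
      · exact Or.inr ⟨rfl, h'.mem_right⟩
      · exact absurd h hn.1

theorem precedes_or_precedes {v : List Tx} {a b : Tx} (ha : a ∈ v) (hb : b ∈ v) (hab : a ≠ b) :
    Precedes v a b ∨ Precedes v b a := by
  induction v with
  | nil => simp at ha
  | cons x l ih =>
    rw [precedes_cons, precedes_cons]
    rcases List.mem_cons.1 ha with rfl | ha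
    · rcases List.mem_cons.1 hb with rfl | hb
      · exact absurd rfl hab
      · exact Or.inl (Or.inr ⟨rfl, hb⟩)
    · rcases List.mem_cons.1 hb with rfl | hb
      · exact Or.inr (Or.inr ⟨rfl, by assumption⟩)
      · rcases ih ha hb with h | h
        · exact Or.inl (Or.inl h)
        · exact Or.inr (Or.inl h)

theorem mem_takeWhile_of_precedes {p : Tx → Bool} {L : List Tx} {τ : Tx} (hτ : τ ∈ L)
    (h : ∀ x, x = τ ∨ Precedes L x τ → p x = true) : τ ∈ L.takeWhile p := by
  induction L with
  | nil => simp at hτ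
  | cons x l ih =>
    rcases List.mem_cons.1 hτ with rfl | hm
    · simp [h τ (Or.inl rfl)]
    · have hx : p x = true := h x (Or.inr (precedes_cons.2 (Or.inr ⟨rfl, hm⟩)))
      rw [List.takeWhile_cons, if_pos hx]
      refine List.mem_cons_of_mem _ (ih hm fun y hy => h y ?_)
      exact hy.imp id fun hy => precedes_cons.2 (Or.inl hy)

/-! ### Relations -/

/-- The relation has no directed cycle. -/
def Acyclic {α : Type*} (R : α → α → Prop) : Prop := ∀ x, ¬ TransGen R x x

theorem Acyclic.mono {α : Type*} {R S : α → α → Prop} (h : Acyclic S) (hRS : ∀ a b, R a b → S a b) :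
    Acyclic R :=
  fun x hx => h x (TransGen.mono hRS _ _ hx)

/-- Between two uses of the new edge, a walk runs from `b` to `a` inside `R`; this is the last
alternative. -/
theorem transGen_insert_cases {α : Type*} {R : α → α → Prop} {a b x y : α}
    (h : TransGen (fun u v => R u v ∨ u = a ∧ v = b) x y) :
    TransGen R x y ∨ ReflTransGen R x a ∧ ReflTransGen R b y ∨ ReflTransGen R b a := by
  induction h with
  | single h =>
    rcases h with h | ⟨rfl, rfl⟩
    · exact Or.inl (.single h)
    · exact Or.inr (Or.inl ⟨.refl, .refl⟩)
  | tail _ h ih =>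
    rcases ih with ih | ⟨h₁, h₂⟩ | ih
    · rcases h with h | ⟨rfl, rfl⟩
      · exact Or.inl (ih.tail h)
      · exact Or.inr (Or.inl ⟨ih.to_reflTransGen, .refl⟩)
    · rcases h with h | ⟨rfl, rfl⟩
      · exact Or.inr (Or.inl ⟨h₁, h₂.tail h⟩)
      · exact Or.inr (Or.inr h₂)
    · exact Or.inr (Or.inr ih)

theorem Acyclic.insert {α : Type*} {R : α → α → Prop} (hR : Acyclic R) {a b : α}
    (h : ¬ ReflTransGen R b a) : Acyclic (fun u v => R u v ∨ u = a ∧ v = b) := by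
  intro x hx
  rcases transGen_insert_cases hx with h' | ⟨h₁, h₂⟩ | h'
  · exact hR x h'
  · exact h (h₂.trans h₁)
  · exact h h'

/-- A walk either uses edges of the first kind only, or it has a last edge of the second kind. -/
theorem transGen_or_cases {α : Type*} {R S : α → α → Prop} {x y : α}
    (h : TransGen (fun u v => R u v ∨ S u v) x y) :
    TransGen R x y ∨ ∃ c d, S c d ∧ ReflTransGen R d y := by
  induction h with
  | single h =>
    rcases h with h | h
    · exact Or.inl (.single h)
    · exact Or.inr ⟨_, _, h, .refl⟩
  | tail _ h ih =>
    rcases h with h | h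
    · rcases ih with ih | ⟨c, d, hc, hd⟩
      · exact Or.inl (ih.tail h)
      · exact Or.inr ⟨c, d, hc, hd.tail h⟩
    · exact Or.inr ⟨_, _, h, .refl⟩

/-- Walks are preserved by a map that is only well behaved on the vertices lying on them. -/
theorem reflTransGen_lift_between {α β : Type*} {R : α → α → Prop} {S : β → β → Prop} {f : α → β}
    {x y : α} (h : ReflTransGen R x y)
    (hf : ∀ u v, ReflTransGen R x u → R u v → ReflTransGen R v y → ReflTransGen S (f u) (f v)) :
    ReflTransGen S (f x) (f y) := by
  induction h using ReflTransGen.head_induction_on with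
  | refl => exact .refl
  | head h h' ih =>
    exact (hf _ _ .refl h h').trans (ih fun u v hu huv hv => hf u v (.head h hu) huv hv)

/-- Reachability is a partial order, and `V` is sorted by a linear extension of it. -/
theorem Acyclic.exists_sort {R : Tx → Tx → Prop} (hR : Acyclic R) (V : Finset Tx) :
    ∃ L : List Tx, L.Nodup ∧ (∀ x, x ∈ L ↔ x ∈ V) ∧ ∀ a ∈ V, ∀ b ∈ V, R a b → Precedes L a b := by
  classical
  have : IsPartialOrder Tx (ReflTransGen R) :=
    { refl := fun _ => .refl
      trans := fun _ _ _ => ReflTransGen.trans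
      antisymm := fun a b hab hba => by
        rcases reflTransGen_iff_eq_or_transGen.1 hab with h | h
        · exact h.symm
        · exact absurd (TransGen.trans_left h hba) (hR a) }
  obtain ⟨s, hs, hle⟩ := extend_partialOrder (ReflTransGen R)
  refine ⟨V.sort s, V.sort_nodup s, fun x => V.mem_sort s, fun a ha b hb hab => ?_⟩
  have hne : a ≠ b := by rintro rfl; exact hR a (.single hab)
  rcases precedes_or_precedes ((V.mem_sort s).2 ha) ((V.mem_sort s).2 hb) hne with h | h
  · exact h
  · have h₁ := List.pairwise_iff_forall_sublist.1 (V.pairwise_sort s) h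
    exact absurd (antisymm (hle _ _ (.single hab)) h₁) hne

/-! ### Profiles -/

/-- The votes in `σ'` extend those in `σ`, and have no repetitions. -/
def Extends (σ σ' : Fin n → List Tx) : Prop := ∀ i, σ i <+: σ' i ∧ (σ' i).Nodup

theorem Extends.trans {σ₁ σ₂ σ₃ : Fin n → List Tx} (h : Extends σ₁ σ₂) (h' : Extends σ₂ σ₃) :
    Extends σ₁ σ₃ :=
  fun i => ⟨(h i).1.trans (h' i).1, (h' i).2⟩

theorem Extends.refl {σ : Fin n → List Tx} (h : ∀ i, (σ i).Nodup) : Extends σ σ :=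
  fun i => ⟨List.prefix_rfl, h i⟩

open Classical in
/-- The number of replicas that report `a ≺ b`. -/
noncomputable def support (σ : Fin n → List Tx) (a b : Tx) : ℕ :=
  (Finset.univ.filter fun i => Precedes (σ i) a b).card

theorem voteFraction_eq_iff (hn : 0 < n) {σ : Fin n → List Tx} {a b : Tx} {k : ℕ} :
    voteFraction σ a b = (k : ℚ) / n ↔ support σ a b = k := by
  have : (n : ℚ) ≠ 0 := by exact_mod_cast hn.ne'
  unfold voteFraction support
  rw [div_left_inj' this]
  norm_cast

theorem voteFraction_eq_one (hn : 0 < n) {σ : Fin n → List Tx} {a b : Tx} :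
    voteFraction σ a b = 1 ↔ support σ a b = n := by
  rw [← voteFraction_eq_iff hn, div_self (by exact_mod_cast hn.ne')]

theorem voteFraction_eq_zero (hn : 0 < n) {σ : Fin n → List Tx} {a b : Tx} :
    voteFraction σ a b = 0 ↔ support σ a b = 0 := by
  rw [← voteFraction_eq_iff hn]
  simp

theorem mem_weightClass (hn : 0 < n) {σ : Fin n → List Tx} {k : ℕ} {a b : Tx} :
    (a, b) ∈ weightClass σ k ↔
      (a ∈ common σ ∧ b ∈ common σ ∧ a ≠ b) ∧ support σ a b = k := by
  simp [weightClass, weight, voteFraction_eq_iff hn]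

theorem mem_common (hn : 0 < n) {σ : Fin n → List Tx} {a : Tx} :
    a ∈ common σ ↔ ∀ i, a ∈ σ i := by
  simp only [common, Finset.mem_filter, Finset.mem_biUnion, Finset.mem_univ, true_and,
    List.mem_toFinset, and_iff_right_iff_imp]
  exact fun h => ⟨⟨0, hn⟩, h _⟩

theorem common_subset (hn : 0 < n) {σ σ' : Fin n → List Tx} (h : Extends σ σ') {a : Tx}
    (ha : a ∈ common σ) : a ∈ common σ' := by
  rw [mem_common hn] at *
  exact fun i => (h i).1.subset (ha i)

theorem support_le (σ : Fin n → List Tx) (a b : Tx) : support σ a b ≤ n := by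
  classical
  simpa [support] using Finset.card_le_univ (Finset.univ.filter fun i => Precedes (σ i) a b)

theorem support_eq_card_iff {σ : Fin n → List Tx} {a b : Tx} :
    support σ a b = n ↔ ∀ i, Precedes (σ i) a b := by
  classical
  have := Finset.card_filter_eq_iff (s := Finset.univ) (p := fun i : Fin n => Precedes (σ i) a b)
  simpa [support] using this

theorem support_pos_iff {σ : Fin n → List Tx} {a b : Tx} :
    0 < support σ a b ↔ ∃ i, Precedes (σ i) a b := by
  classical
  simp [support, Finset.card_pos, Finset.filter_nonempty_iff]

theorem support_extends (hn : 0 < n) {σ σ' : Fin n → List Tx} (h : Extends σ σ') {a b : Tx}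
    (hb : b ∈ common σ) : support σ' a b = support σ a b := by
  classical
  unfold support
  congr 1
  ext i
  simp only [Finset.mem_filter, Finset.mem_univ, true_and]
  exact ⟨fun hi => hi.of_extension (h i).1 (h i).2 ((mem_common hn).1 hb i), fun hi => hi.mono (h i).1⟩

theorem support_add_support (hn : 0 < n) {σ : Fin n → List Tx} (hσ : ∀ i, (σ i).Nodup) {a b : Tx}
    (ha : a ∈ common σ) (hb : b ∈ common σ) (hab : a ≠ b) :
    support σ a b + support σ b a = n := by
  classical
  have : (Finset.univ.filter fun i => Precedes (σ i) b a) =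
      Finset.univ.filter fun i => ¬ Precedes (σ i) a b := by
    ext i
    simp only [Finset.mem_filter, Finset.mem_univ, true_and]
    refine ⟨fun h h' => (h.trans (hσ i) h').ne (hσ i) rfl, fun h => ?_⟩
    exact (precedes_or_precedes ((mem_common hn).1 ha i) ((mem_common hn).1 hb i) hab).resolve_left h
  unfold support
  rw [this, Finset.card_filter_add_card_filter_not]
  simp

/-- The part of each vote before `p` is fixed, and a transaction missing from a later vote was
missing earlier. So a common transaction can lose this property over time but not gain it. -/
theorem futurePrecedes_of_extends (hn : 0 < n) {σ σ' : Fin n → List Tx} (h : Extends σ σ') {p : Tx}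
    (hp : p ∈ common σ) (hf : FuturePrecedes σ' p) : FuturePrecedes σ p := by
  obtain ⟨y, -, ⟨j, hj⟩, i, hi⟩ := hf
  have := hi.of_extension (h i).1 (h i).2 ((mem_common hn).1 hp i)
  exact ⟨y, ⟨i, this.mem_left⟩, ⟨j, fun hy => hj ((h j).1.subset hy)⟩, i, this⟩

theorem futurePrecedes_of_unanimous {σ : Fin n → List Tx} (hσ : ∀ i, (σ i).Nodup) {p q : Tx}
    (hpq : support σ p q = n) (hf : FuturePrecedes σ p) : FuturePrecedes σ q := by
  obtain ⟨y, h₁, h₂, i, hi⟩ := hf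
  exact ⟨y, h₁, h₂, i, hi.trans (hσ i) (support_eq_card_iff.1 hpq i)⟩

theorem none_mem_neighborhood {σ : Fin n → List Tx} {a b : Tx} : none ∈ neighborhood σ a b := by
  simp [neighborhood]

theorem some_mem_neighborhood (hn : 0 < n) {σ : Fin n → List Tx} {a b x : Tx} :
    some x ∈ neighborhood σ a b ↔
      x ∈ common σ ∧ (x ≠ a → support σ x a ≠ 0) ∧ (x ≠ b → support σ x b ≠ n) := by
  simp only [neighborhood, subsequent, preceding, voteFraction_eq_one hn, voteFraction_eq_zero hn,
    Set.mem_insert_iff, reduceCtorEq, Set.mem_image, Set.mem_sdiff, Set.mem_union,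
    Set.mem_ofPred_eq, Option.some.injEq, exists_eq_right, false_or, Finset.mem_coe]
  tauto

/-! ### Invariants of a run -/

/-- The edge from `a` to `b` is left out of `H`. -/
def IsExcluded (H : Decisions Tx) (e : Option Tx × Option Tx) : Prop := H e = some .excluded

/-- The determinate edges between transactions that at least `s` replicas support. -/
def DetEdge (σ : Fin n → List Tx) (H : Decisions Tx) (s : ℕ) (x y : Tx) : Prop :=
  IsDet H (some x, some y) ∧ s ≤ support σ x y

/-- The determinate edges of support exactly `k` can be added to every acyclic set of edges of a
later profile that have larger support, contain all unanimous ones, and are not excluded. -/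
def Insertable (σ : Fin n → List Tx) (H : Decisions Tx) (k : ℕ) : Prop :=
  ∀ (σ' : Fin n → List Tx) (G : Tx → Tx → Prop), Extends σ σ' →
    (∀ a b, G a b → (a ∈ common σ' ∧ b ∈ common σ' ∧ a ≠ b) ∧ k < support σ' a b) →
    (∀ a b, a ∈ common σ' → b ∈ common σ' → a ≠ b → support σ' a b = n → G a b) →
    (∀ a b, G a b → ¬ IsExcluded H (some a, some b)) → Acyclic G →
    Acyclic fun a b => G a b ∨ IsDet H (some a, some b) ∧ support σ a b = k

/-- What makes an edge `(a, b)` remain indeterminate: an indeterminate edge of larger support, or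
from the future vertex, from whose head a determinate path leads to `a`. -/
def Deferred (σ : Fin n → List Tx) (H : Decisions Tx) (a b : Tx) : Prop :=
  ∃ c d, IsIndet H (c, some d) ∧ (∀ c', c = some c' → support σ a b < support σ c' d) ∧
    some d ∈ neighborhood σ a b ∧ ReflTransGen (DetEdge σ H 0) d a

/-- The properties that hold of the decisions at each moment of a run on the votes `σ`. -/
structure Valid (σ : Fin n → List Tx) (H : Decisions Tx) : Prop where
  dom : ∀ a b, H (some a, some b) ≠ none → a ∈ common σ ∧ b ∈ common σ ∧ a ≠ b
  -- The bound on the supports matters for the oracle: when an exclusion is adopted, the edges of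
  -- its path have been adopted as well.
  excluded_path : ∀ a b, IsExcluded H (some a, some b) →
    TransGen (DetEdge σ H (support σ a b)) b a
  -- Needed for `antisymm`: an oracle that accepted a minority edge has also excluded the heavier
  -- reverse, so that one cannot become indeterminate later.
  reverse : ∀ a b, IsDet H (some a, some b) → support σ a b < support σ b a →
    IsExcluded H (some b, some a)
  -- Otherwise the path from `b` over the future vertex to `a` would have prevented acceptance.
  future : ∀ a b, IsDet H (some a, some b) → FuturePrecedes σ a → support σ a b = n
  excluded_ne : ∀ a b, IsExcluded H (some a, some b) → support σ a b ≠ n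
  indet_ne : ∀ a b, IsIndet H (some a, some b) → support σ a b ≠ n
  antisymm : ∀ a b, IsIndet H (some a, some b) → ¬ IsDet H (some b, some a)
  deferred : ∀ a b, IsIndet H (some a, some b) → Deferred σ H a b
  insertable : ∀ k < n, Insertable σ H k
  not_det_left : ∀ x, ¬ IsDet H (none, x)
  not_det_right : ∀ x, ¬ IsDet H (x, none)

/-- The classes of support at least `k` are decided, in agreement with the oracle, and the other
edges between transactions are open. -/
structure Progress (σ : Fin n → List Tx) (O : Decisions Tx) (k : ℕ) (H : Decisions Tx) :
    Prop where
  to_future : ∀ x, H (x, none) = initial σ (x, none)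
  from_future : ∀ x, H (none, x) = initial σ (none, x)
  decided : ∀ a b, a ∈ common σ → b ∈ common σ → a ≠ b → k ≤ support σ a b →
    H (some a, some b) ≠ none
  undecided : ∀ a b, support σ a b < k → H (some a, some b) = none
  oracle : ∀ a b, k ≤ support σ a b →
    IsDet O (some a, some b) ∨ IsExcluded O (some a, some b) →
    H (some a, some b) = O (some a, some b)

/-- The class of support `k` is being worked on. -/
structure InClass (σ : Fin n → List Tx) (O : Decisions Tx) (k : ℕ) (H : Decisions Tx) :
    Prop where
  to_future : ∀ x, H (x, none) = initial σ (x, none)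
  from_future : ∀ x, H (none, x) = initial σ (none, x)
  decided : ∀ a b, a ∈ common σ → b ∈ common σ → a ≠ b → k < support σ a b →
    H (some a, some b) ≠ none
  undecided : ∀ a b, support σ a b < k → H (some a, some b) = none
  not_indet : ∀ a b, support σ a b = k → ¬ IsIndet H (some a, some b)
  oracle : ∀ a b, k ≤ support σ a b →
    IsDet O (some a, some b) ∨ IsExcluded O (some a, some b) →
    H (some a, some b) = O (some a, some b)

theorem DetEdge.mono {σ : Fin n → List Tx} {H H' : Decisions Tx} {s : ℕ}
    (h : ∀ a b, IsDet H (some a, some b) → IsDet H' (some a, some b)) (a b : Tx)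
    (hab : DetEdge σ H s a b) : DetEdge σ H' s a b :=
  ⟨h a b hab.1, hab.2⟩

theorem Deferred.mono {σ : Fin n → List Tx} {H H' : Decisions Tx}
    (hd : ∀ a b, IsDet H (some a, some b) → IsDet H' (some a, some b))
    (hi : ∀ e, IsIndet H e → IsIndet H' e) {a b : Tx} (h : Deferred σ H a b) :
    Deferred σ H' a b := by
  obtain ⟨c, d, h₁, h₂, h₃, h₄⟩ := h
  exact ⟨c, d, hi _ h₁, h₂, h₃, ReflTransGen.mono (DetEdge.mono hd) _ _ h₄⟩

theorem initial_some (σ : Fin n → List Tx) (a b : Tx) : initial σ (some a, some b) = none := by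
  simp [initial]

theorem initial_to_future {σ : Fin n → List Tx} {a : Tx} (ha : a ∈ common σ) :
    initial σ (some a, none) = some .indeterminate := by
  simp [initial, weight, ha]

theorem initial_from_future {σ : Fin n → List Tx} {a : Tx} :
    initial σ (none, some a) = some .indeterminate ↔ a ∈ common σ ∧ FuturePrecedes σ a := by
  have : (∃ τ ∈ common σ, ((none, some a) = (some τ, (none : Option Tx)) ∨
      (none, some a) = ((none : Option Tx), some τ)) ∧ weight σ none (some a) = 1) ↔
      a ∈ common σ ∧ FuturePrecedes σ a := by
    simp [weight]
  simp [initial, ← this]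

theorem initial_ne_det (σ : Fin n → List Tx) (e : Option Tx × Option Tx) :
    initial σ e ≠ some .determinate := by
  unfold initial
  split_ifs <;> simp

theorem insertable_of_forall_not_det {σ : Fin n → List Tx} {H : Decisions Tx} {k : ℕ}
    (h : ∀ a b, support σ a b = k → ¬ IsDet H (some a, some b)) : Insertable σ H k := by
  intro σ' G _ _ _ _ hG
  refine hG.mono fun a b hab => hab.resolve_right fun hab => h a b hab.2 hab.1

theorem Insertable.congr {σ : Fin n → List Tx} {H H' : Decisions Tx} {k : ℕ}
    (h : Insertable σ H k)
    (hd : ∀ a b, support σ a b = k → IsDet H' (some a, some b) → IsDet H (some a, some b))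
    (he : ∀ a b, IsExcluded H (some a, some b) → IsExcluded H' (some a, some b)) :
    Insertable σ H' k := by
  intro σ' G hσ h₁ h₂ h₃ h₄
  refine (h σ' G hσ h₁ h₂ (fun a b hab hx => h₃ a b hab (he a b hx)) h₄).mono fun a b hab => ?_
  exact hab.imp id fun hab => ⟨hd a b hab.2 hab.1, hab.2⟩

theorem valid_initial (σ : Fin n → List Tx) : Valid σ (initial σ) where
  dom a b h := absurd (initial_some σ a b) h
  excluded_path a b h := by simp [IsExcluded, initial_some] at h
  reverse a b h := by simp [IsDet, initial_some] at h
  future a b h := by simp [IsDet, initial_some] at h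
  excluded_ne a b h := by simp [IsExcluded, initial_some] at h
  indet_ne a b h := by simp [IsIndet, initial_some] at h
  antisymm a b h := by simp [IsIndet, initial_some] at h
  deferred a b h := by simp [IsIndet, initial_some] at h
  insertable k _ := insertable_of_forall_not_det fun a b _ h => by simp [IsDet, initial_some] at h
  not_det_left _ := initial_ne_det σ _
  not_det_right _ := initial_ne_det σ _

theorem valid_empty (σ : Fin n → List Tx) : Valid σ fun _ => none where
  dom a b h := absurd rfl h
  excluded_path a b h := by simp [IsExcluded] at h
  reverse a b h := by simp [IsDet] at h
  future a b h := by simp [IsDet] at h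
  excluded_ne a b h := by simp [IsExcluded] at h
  indet_ne a b h := by simp [IsIndet] at h
  antisymm a b h := by simp [IsIndet] at h
  deferred a b h := by simp [IsIndet] at h
  insertable k _ := insertable_of_forall_not_det fun a b _ h => by simp [IsDet] at h
  not_det_left x h := by simp [IsDet] at h
  not_det_right x h := by simp [IsDet] at h

theorem progress_initial (σ : Fin n → List Tx) (O : Decisions Tx) :
    Progress σ O (n + 1) (initial σ) where
  to_future _ := rfl
  from_future _ := rfl
  decided a b _ _ _ h := by have := support_le σ a b; omega
  undecided a b _ := initial_some σ a b
  oracle a b h := by have := support_le σ a b; omega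

/-! ### Consulting the oracle -/

section Oracle

variable {σ₀ σ : Fin n → List Tx} {O H : Decisions Tx} {k : ℕ} {es : List (Tx × Tx)}

theorem consultOracle_of_support_ne (hes : ∀ a b, (a, b) ∈ es → support σ a b = k) {a b : Tx}
    (h : support σ a b ≠ k) : consultOracle O es H (some a, some b) = H (some a, some b) := by
  unfold consultOracle
  rw [if_neg]
  rintro ⟨⟨⟨a', b'⟩, hp, he⟩, -⟩
  simp only [toEdge, Prod.mk.injEq, Option.some.injEq] at he
  obtain ⟨rfl, rfl⟩ := he
  exact h (hes _ _ hp)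

theorem consultOracle_to_future (x : Option Tx) :
    consultOracle O es H (x, none) = H (x, none) := by
  simp [consultOracle, toEdge]

theorem consultOracle_from_future (x : Option Tx) :
    consultOracle O es H (none, x) = H (none, x) := by
  simp [consultOracle, toEdge]

theorem consultOracle_eq_oracle {a b : Tx} (hab : (a, b) ∈ es)
    (h : IsDet O (some a, some b) ∨ IsExcluded O (some a, some b)) :
    consultOracle O es H (some a, some b) = O (some a, some b) := by
  unfold consultOracle
  rw [if_pos]
  exact ⟨⟨(a, b), hab, rfl⟩, h⟩

/-- On an open class, the decisions after consulting the oracle are those of the oracle. -/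
theorem consultOracle_cases (e : Option Tx × Option Tx) :
    consultOracle O es H e = H e ∨ (∃ p ∈ es, e = toEdge p) ∧
      (IsDet O e ∨ IsExcluded O e) ∧ consultOracle O es H e = O e := by
  unfold consultOracle
  split_ifs with h
  · exact Or.inr ⟨h.1, h.2, rfl⟩
  · exact Or.inl rfl

theorem consultOracle_inClass (hn : 0 < n)
    (hes : ∀ e, e ∈ es ↔ e ∈ weightClass σ k) (hσ : Extends σ₀ σ) (hO : Valid σ₀ O)
    (hP : Progress σ O (k + 1) H) : InClass σ O k (consultOracle O es H) := by
  have hes' : ∀ a b, (a, b) ∈ es → support σ a b = k := fun a b h =>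
    ((mem_weightClass hn).1 ((hes _).1 h)).2
  refine ⟨fun x => ?_, fun x => ?_, fun a b ha hb hab h => ?_, fun a b h => ?_, fun a b h => ?_,
    fun a b h h' => ?_⟩
  · rw [consultOracle_to_future, hP.to_future]
  · rw [consultOracle_from_future, hP.from_future]
  · rw [consultOracle_of_support_ne hes' h.ne']
    exact hP.decided a b ha hb hab h
  · rw [consultOracle_of_support_ne hes' h.ne]
    exact hP.undecided a b (by omega)
  · unfold IsIndet
    rcases consultOracle_cases (O := O) (H := H) (es := es) (some a, some b) with h' | ⟨-, h₁, h₂⟩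
    · rw [h', hP.undecided a b (by omega)]; simp
    · rw [h₂]
      rcases h₁ with h₁ | h₁ <;> rw [h₁] <;> simp
  · rcases h.eq_or_lt with h | h
    · refine consultOracle_eq_oracle ((hes _).2 ((mem_weightClass hn).2 ⟨?_, h.symm⟩)) h'
      have := hO.dom a b (by rcases h' with h' | h' <;> rw [h'] <;> simp)
      exact ⟨common_subset hn hσ this.1, common_subset hn hσ this.2.1, this.2.2⟩
    · rw [consultOracle_of_support_ne hes' h.ne']
      exact hP.oracle a b h h'

theorem consultOracle_valid (hn : 0 < n)
    (hes : ∀ e, e ∈ es ↔ e ∈ weightClass σ k) (hσ : Extends σ₀ σ) (hO : Valid σ₀ O)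
    (hH : Valid σ H) (hP : Progress σ O (k + 1) H) : Valid σ (consultOracle O es H) := by
  have hC := consultOracle_inClass hn hes hσ hO hP
  set H' := consultOracle O es H with hH'
  have hcases : ∀ a b, H' (some a, some b) = H (some a, some b) ∨ H (some a, some b) = none ∧
      ((a ∈ common σ ∧ b ∈ common σ ∧ a ≠ b) ∧ support σ a b = k) ∧
      (IsDet O (some a, some b) ∨ IsExcluded O (some a, some b)) ∧
      H' (some a, some b) = O (some a, some b) := by
    intro a b
    rcases consultOracle_cases (O := O) (H := H) (es := es) (some a, some b) with
      h | ⟨⟨p, hp, he⟩, h₁, h₂⟩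
    · exact Or.inl h
    · obtain ⟨a', b'⟩ := p
      simp only [toEdge, Prod.mk.injEq, Option.some.injEq] at he
      obtain ⟨rfl, rfl⟩ := he
      have := (mem_weightClass hn).1 ((hes _).1 hp)
      exact Or.inr ⟨hP.undecided _ _ (by omega), this, h₁, h₂⟩
  have hOdom : ∀ a b, IsDet O (some a, some b) ∨ IsExcluded O (some a, some b) →
      (a ∈ common σ₀ ∧ b ∈ common σ₀ ∧ a ≠ b) ∧ support σ a b = support σ₀ a b ∧
        support σ b a = support σ₀ b a := by
    intro a b h
    have := hO.dom a b (by rcases h with h | h <;> rw [h] <;> simp)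
    exact ⟨this, support_extends hn hσ this.2.1, support_extends hn hσ this.1⟩
  have hmono : ∀ a b D, H (some a, some b) = some D → H' (some a, some b) = some D := by
    intro a b D h
    rcases hcases a b with h' | ⟨h', -⟩
    · rw [h', h]
    · rw [h'] at h; simp at h
  have hindet : ∀ a b, IsIndet H' (some a, some b) → IsIndet H (some a, some b) := by
    intro a b h
    rcases hcases a b with h' | ⟨-, h₁, -⟩
    · unfold IsIndet; rw [← h', h]
    · exact absurd h (hC.not_indet a b h₁.2)
  have hindet' : ∀ e, IsIndet H e → IsIndet H' e := by
    rintro ⟨x | a, y⟩ h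
    · unfold IsIndet; rw [hH', consultOracle_from_future, h]
    · rcases y with _ | b
      · unfold IsIndet; rw [hH', consultOracle_to_future, h]
      · exact hmono a b _ h
  refine ⟨?_, ?_, ?_, ?_, ?_, ?_, ?_, ?_, ?_, ?_, ?_⟩
  · intro a b h
    rcases hcases a b with h' | ⟨-, h₁, -⟩
    · exact hH.dom a b (h' ▸ h)
    · exact h₁.1
  · intro a b h
    rcases hcases a b with h' | ⟨-, h₁, h₂, h₃⟩
    · exact TransGen.mono (DetEdge.mono fun a b h => hmono a b _ h) _ _
        (hH.excluded_path a b (h'.symm.trans h))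
    · have hx : IsExcluded O (some a, some b) := h₃.symm.trans h
      -- The oracle's path uses determinate edges of support at least `k`, all of them adopted by
      -- now.
      refine TransGen.mono ?_ _ _ (hO.excluded_path a b hx)
      rintro x y ⟨hxy, hs⟩
      have h₄ := hOdom x y (Or.inl hxy)
      have h₅ := hOdom a b (Or.inr hx)
      have h₆ : support σ a b ≤ support σ x y := by rw [h₄.2.1, h₅.2.1]; exact hs
      exact ⟨(hC.oracle x y (h₁.2 ▸ h₆) (Or.inl hxy)).trans hxy, h₆⟩
  · intro a b h hlt
    rcases hcases a b with h' | ⟨-, h₁, h₂, h₃⟩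
    · exact hmono _ _ _ (hH.reverse a b (h'.symm.trans h) hlt)
    · have hx : IsDet O (some a, some b) := h₃.symm.trans h
      have h₄ := hOdom a b h₂
      have h₅ := hO.reverse a b hx (by rw [← h₄.2.1, ← h₄.2.2]; exact hlt)
      exact (hC.oracle b a (by omega) (Or.inr h₅)).trans h₅
  · intro a b h hf
    rcases hcases a b with h' | ⟨-, h₁, h₂, h₃⟩
    · exact hH.future a b (h'.symm.trans h) hf
    · have h₄ := hOdom a b h₂
      rw [h₄.2.1]
      exact hO.future a b (h₃.symm.trans h) (futurePrecedes_of_extends hn hσ h₄.1.1 hf)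
  · intro a b h
    rcases hcases a b with h' | ⟨-, h₁, h₂, h₃⟩
    · exact hH.excluded_ne a b (h'.symm.trans h)
    · rw [(hOdom a b h₂).2.1]
      exact hO.excluded_ne a b (h₃.symm.trans h)
  · exact fun a b h => hH.indet_ne a b (hindet a b h)
  · intro a b h hd
    have hi := hindet a b h
    rcases hcases b a with h' | ⟨-, h₁, h₂, h₃⟩
    · exact hH.antisymm a b hi (h'.symm.trans hd)
    · have h₄ := hOdom b a h₂
      have hk : k < support σ a b := by
        by_contra hk
        rw [IsIndet, hP.undecided a b (by omega)] at hi
        simp at hi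
      -- The oracle accepted the lighter edge `(b, a)`, so it excluded `(a, b)`, and this was
      -- adopted in an earlier class.
      have h₅ := hO.reverse b a (h₃.symm.trans hd) (by rw [← h₄.2.1, ← h₄.2.2, h₁.2]; exact hk)
      have h₆ := (hC.oracle a b hk.le (Or.inr h₅)).trans h₅
      rw [IsIndet, h₆] at h
      simp at h
  · exact fun a b h => (hH.deferred a b (hindet a b h)).mono (fun a b h => hmono a b _ h) hindet'
  · intro j hj
    by_cases hjk : j = k
    · subst hjk
      intro σ' G hσ' h₁ h₂ h₃ h₄
      -- Class `k` was open, so its determinate edges are now those of the oracle, and `σ'` is also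
      -- a later profile for the oracle.
      refine (hO.insertable j hj σ' G (hσ.trans hσ') h₁ h₂ (fun a b hab hx => ?_) h₄).mono ?_
      · have h₅ := hOdom a b (Or.inr hx)
        have h₆ := (h₁ a b hab).2
        rw [support_extends hn hσ' (common_subset hn hσ h₅.1.2.1)] at h₆
        exact h₃ a b hab ((hC.oracle a b h₆.le (Or.inr hx)).trans hx)
      · rintro a b (hab | ⟨hab, hs⟩)
        · exact Or.inl hab
        · rcases hcases a b with h' | ⟨-, -, h₅, h₆⟩
          · rw [IsDet, h', hP.undecided a b (by omega)] at hab
            simp at hab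
          · exact Or.inr ⟨h₆.symm.trans hab, by rw [← (hOdom a b h₅).2.1, hs]⟩
    · refine (hH.insertable j hj).congr (fun a b hs h => ?_) fun a b h => hmono a b _ h
      rcases hcases a b with h' | ⟨-, h₁, -⟩
      · exact h'.symm.trans h
      · omega
  · intro x
    rw [IsDet, hH', consultOracle_from_future]
    exact hH.not_det_left x
  · intro x
    rw [IsDet, hH', consultOracle_to_future]
    exact hH.not_det_right x

end Oracle

/-! ### Visiting an edge -/

section Visit

variable {σ : Fin n → List Tx} {O H : Decisions Tx} {k : ℕ} {a b : Tx}

theorem toEdge_injective {p q : Tx × Tx} (h : toEdge p = toEdge q) : p = q := by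
  simp only [toEdge, Prod.mk.injEq, Option.some.injEq] at h
  exact Prod.ext h.1 h.2

/-- No determinate edge touches the future vertex, so a determinate walk to a transaction stays
among transactions. -/
theorem Valid.exists_some_of_reflTransGen (hH : Valid σ H) {s : ℕ}
    (hs : ∀ a b, IsDet H (some a, some b) → s ≤ support σ a b) {U : Set (Option Tx)} {x : Option Tx}
    (h : ReflTransGen (fun u v => u ∈ U ∧ v ∈ U ∧ IsDet H (u, v)) x (some a)) :
    ∃ y, x = some y ∧ ReflTransGen (DetEdge σ H s) y a := by
  induction h using ReflTransGen.head_induction_on with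
  | refl => exact ⟨a, rfl, .refl⟩
  | @head u v huv _ ih =>
    obtain ⟨y, rfl, hy⟩ := ih
    rcases u with _ | u
    · exact absurd huv.2.2 (hH.not_det_left _)
    · exact ⟨u, rfl, .head ⟨huv.2.2, hs _ _ huv.2.2⟩ hy⟩

theorem Valid.transGen_of_hasPath (hH : Valid σ H) {s : ℕ}
    (hs : ∀ a b, IsDet H (some a, some b) → s ≤ support σ a b) {U : Set (Option Tx)}
    (h : HasPath U (IsDet H) (some b) (some a)) : TransGen (DetEdge σ H s) b a := by
  obtain ⟨v, hv, hva⟩ := TransGen.head'_iff.1 h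
  obtain ⟨y, rfl, hy⟩ := hH.exists_some_of_reflTransGen hs hva
  exact TransGen.head' ⟨hv.2.2, hs _ _ hv.2.2⟩ hy

theorem HasPath.right_mem {U : Set (Option Tx)} {ok : Option Tx × Option Tx → Prop}
    {x y : Option Tx} (h : HasPath U ok x y) : y ∈ U := by
  obtain ⟨_, _, h⟩ := TransGen.tail'_iff.1 h
  exact h.2.1

/-- For a unanimous edge, `a` lies in `P_b` and hence outside `U_{a,b}`. Such an edge is therefore
never excluded or deferred. -/
theorem HasPath.support_ne (hn : 0 < n) {ok : Option Tx × Option Tx → Prop} (hab : a ≠ b)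
    {x : Option Tx} (h : HasPath (neighborhood σ a b) ok x (some a)) : support σ a b ≠ n :=
  ((some_mem_neighborhood hn).1 h.right_mem).2.2 hab

theorem InClass.le_support_of_ne_none (hC : InClass σ O k H) (h : H (some a, some b) ≠ none) :
    k ≤ support σ a b := by
  by_contra hlt
  exact h (hC.undecided a b (by omega))

open Classical in
theorem InClass.update (hC : InClass σ O k H) (hk : support σ a b = k)
    (h : H (some a, some b) = none) {D : Decision} (hD : D ≠ .indeterminate) :
    InClass σ O k (Function.update H (some a, some b) (some D)) := by
  have hne : ∀ x y, (x, y) ≠ (a, b) → Function.update H (some a, some b) (some D) (some x, some y) =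
      H (some x, some y) := by
    intro x y hxy
    refine Function.update_of_ne ?_ _ _
    simpa using hxy
  refine ⟨fun x => ?_, fun x => ?_, fun x y hx hy hxy hs => ?_, fun x y hs => ?_, fun x y hs => ?_,
    fun x y hs ho => ?_⟩
  · rw [Function.update_of_ne (by simp)]; exact hC.to_future x
  · rw [Function.update_of_ne (by simp)]; exact hC.from_future x
  · rw [hne x y (by rintro ⟨⟩; omega)]
    exact hC.decided x y hx hy hxy hs
  · rw [hne x y (by rintro ⟨⟩; omega)]
    exact hC.undecided x y hs
  · by_cases hxy : (x, y) = (a, b)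
    · cases hxy
      simpa [IsIndet] using hD
    · rw [IsIndet, hne x y hxy]
      exact hC.not_indet x y hs
  · by_cases hxy : (x, y) = (a, b)
    · cases hxy
      have := hC.oracle _ _ hs ho
      rw [h] at this
      rcases ho with ho | ho <;> rw [ho] at this <;> simp at this
    · rw [hne x y hxy]
      exact hC.oracle x y hs ho

open Classical in
theorem Valid.update_excluded (hn : 0 < n) (hH : Valid σ H) (hC : InClass σ O k H)
    (hab : (a ∈ common σ ∧ b ∈ common σ ∧ a ≠ b) ∧ support σ a b = k)
    (h : H (some a, some b) = none)
    (hp : HasPath (neighborhood σ a b) (IsDet H) (some b) (some a)) :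
    Valid σ (Function.update H (some a, some b) (some .excluded)) := by
  set H' := Function.update H (some a, some b) (some .excluded) with hH'
  have hold : ∀ e, H' e = H e ∨ e = (some a, some b) ∧ H' e = some .excluded := by
    intro e
    by_cases he : e = (some a, some b)
    · subst he; exact Or.inr ⟨rfl, Function.update_self ..⟩
    · exact Or.inl (Function.update_of_ne he ..)
  have hmono : ∀ e D, H e = some D → H' e = some D := by
    intro e D he
    rcases hold e with h' | ⟨rfl, -⟩
    · rw [h', he]
    · rw [h] at he; simp at he
  have hdet : ∀ e, IsDet H' e → IsDet H e := by
    intro e he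
    rcases hold e with h' | ⟨rfl, h'⟩
    · exact h'.symm.trans he
    · rw [IsDet, h'] at he; simp at he
  have hindet : ∀ e, IsIndet H' e → IsIndet H e := by
    intro e he
    rcases hold e with h' | ⟨rfl, h'⟩
    · exact h'.symm.trans he
    · rw [IsIndet, h'] at he; simp at he
  have hexcl : ∀ x y, IsExcluded H' (some x, some y) → IsExcluded H (some x, some y) ∨
      x = a ∧ y = b := by
    intro x y he
    rcases hold (some x, some y) with h' | ⟨h', -⟩
    · exact Or.inl (h'.symm.trans he)
    · exact Or.inr (by simpa using h')
  have hs : ∀ x y, IsDet H (some x, some y) → k ≤ support σ x y := fun x y hxy =>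
    hC.le_support_of_ne_none (by rw [hxy]; simp)
  refine ⟨?_, ?_, ?_, ?_, ?_, ?_, ?_, ?_, ?_, ?_, ?_⟩
  · intro x y hxy
    rcases hold (some x, some y) with h' | ⟨h', -⟩
    · exact hH.dom x y (h' ▸ hxy)
    · simp only [Prod.mk.injEq, Option.some.injEq] at h'
      obtain ⟨rfl, rfl⟩ := h'
      exact hab.1
  · intro x y hxy
    refine TransGen.mono (DetEdge.mono fun _ _ h => hmono _ _ h) _ _ ?_
    rcases hexcl x y hxy with hxy | ⟨rfl, rfl⟩
    · exact hH.excluded_path x y hxy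
    · rw [hab.2]
      exact hH.transGen_of_hasPath hs hp
  · exact fun x y hxy hlt => hmono _ _ (hH.reverse x y (hdet _ hxy) hlt)
  · exact fun x y hxy => hH.future x y (hdet _ hxy)
  · intro x y hxy
    rcases hexcl x y hxy with hxy | ⟨rfl, rfl⟩
    · exact hH.excluded_ne x y hxy
    · exact hp.support_ne hn hab.1.2.2
  · exact fun x y hxy => hH.indet_ne x y (hindet _ hxy)
  · exact fun x y hxy hyx => hH.antisymm x y (hindet _ hxy) (hdet _ hyx)
  · exact fun x y hxy => (hH.deferred x y (hindet _ hxy)).mono (fun _ _ h => hmono _ _ h)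
      fun _ h => hmono _ _ h
  · exact fun j hj => (hH.insertable j hj).congr (fun _ _ _ h => hdet _ h) fun _ _ h => hmono _ _ h
  · exact fun x hx => hH.not_det_left x (hdet _ hx)
  · exact fun x hx => hH.not_det_right x (hdet _ hx)

/-- If there is no path from `b` to `a` in the neighborhood of `(a, b)`, then there is none that
uses edges of a later profile. -/
theorem Valid.not_reflTransGen (hn : 0 < n) (hσ : ∀ i, (σ i).Nodup) (hH : Valid σ H)
    (hC : InClass σ O k H) (hab : a ∈ common σ ∧ b ∈ common σ ∧ a ≠ b)
    (hp : ¬ HasPath (neighborhood σ a b) (fun f => IsDet H f ∨ IsIndet H f) (some b) (some a))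
    {σ' : Fin n → List Tx} {G : Tx → Tx → Prop} (hσ' : Extends σ σ')
    (h₁ : ∀ a b, G a b → (a ∈ common σ' ∧ b ∈ common σ' ∧ a ≠ b) ∧ k < support σ' a b)
    (h₂ : ∀ a b, a ∈ common σ' → b ∈ common σ' → a ≠ b → support σ' a b = n → G a b)
    (h₃ : ∀ a b, G a b → ¬ IsExcluded H (some a, some b))
    (hR : Acyclic fun a b => G a b ∨ IsDet H (some a, some b) ∧ support σ a b = k) :
    ¬ ReflTransGen (fun a b => G a b ∨ IsDet H (some a, some b) ∧ support σ a b = k) b a := by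
  classical
  intro hpath
  set R := fun a b => G a b ∨ IsDet H (some a, some b) ∧ support σ a b = k with hRdef
  -- Contract all transactions that are not yet common in `σ` to the future vertex.
  let f : Tx → Option Tx := fun x => if x ∈ common σ then some x else none
  have hunan : ∀ x y, x ∈ common σ → y ∈ common σ → x ≠ y → support σ x y = n → R x y := by
    intro x y hx hy hxy hs
    refine Or.inl (h₂ x y (common_subset hn hσ' hx) (common_subset hn hσ' hy) hxy ?_)
    rw [support_extends hn hσ' hy, hs]
  have hmem : ∀ x, ReflTransGen R b x → ReflTransGen R x a → f x ∈ neighborhood σ a b := by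
    intro x hbx hxa
    by_cases hx : x ∈ common σ
    · simp only [f, if_pos hx]
      -- A common transaction on the walk that lay outside `U_{a,b}` would be unanimously after `a`
      -- or before `b`; that unanimous edge closes a cycle in `R`.
      refine (some_mem_neighborhood hn).2 ⟨hx, fun hne h0 => ?_, fun hne hs => ?_⟩
      · have := support_add_support hn hσ hx hab.1 hne
        exact hR x (TransGen.tail' hxa (hunan a x hab.1 hx hne.symm (by omega)))
      · exact hR b (TransGen.tail' hbx (hunan x b hx hab.2.1 hne hs))
    · simp only [f, if_neg hx]
      exact none_mem_neighborhood
  have hlift := reflTransGen_lift_between (f := f) (S := fun u v => u ∈ neighborhood σ a b ∧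
    v ∈ neighborhood σ a b ∧ (IsDet H (u, v) ∨ IsIndet H (u, v))) hpath ?_
  · simp only [f, if_pos hab.1, if_pos hab.2.1] at hlift
    rcases reflTransGen_iff_eq_or_transGen.1 hlift with h | h
    · exact hab.2.2 (Option.some.inj h)
    · exact hp h
  · intro u v hbu huv hva
    have hu := hmem u hbu (.head huv hva)
    have hv := hmem v (hbu.tail huv) hva
    by_cases hcu : u ∈ common σ <;> by_cases hcv : v ∈ common σ
    · refine .single ⟨hu, hv, ?_⟩
      simp only [f, if_pos hcu, if_pos hcv]
      rcases huv with huv | huv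
      · have h4 := h₁ u v huv
        have h5 := h₃ u v huv
        rw [support_extends hn hσ' hcv] at h4
        have h6 := hC.decided u v hcu hcv h4.1.2.2 h4.2
        unfold IsDet IsIndet
        unfold IsExcluded at h5
        rcases hd : H (some u, some v) with _ | D
        · exact absurd hd h6
        · cases D <;> simp_all
      · exact Or.inl huv.1
    · refine .single ⟨hu, hv, Or.inr ?_⟩
      simp only [f, if_pos hcu, if_neg hcv]
      exact (hC.to_future _).trans (initial_to_future hcu)
    · refine .single ⟨hu, hv, Or.inr ?_⟩
      simp only [f, if_neg hcu, if_pos hcv]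
      refine (hC.from_future _).trans (initial_from_future.2 ⟨hcv, ?_⟩)
      rcases huv with huv | huv
      -- The support exceeds `k`, so some vote has `u` before `v`. Since `v` is common in `σ`, that
      -- vote already contained `u`, which is seen but not common.
      · obtain ⟨i, hi⟩ := support_pos_iff.1 (Nat.zero_lt_of_lt (h₁ u v huv).2)
        have hi' := hi.of_extension (hσ' i).1 (hσ' i).2 ((mem_common hn).1 hcv i)
        rw [mem_common hn, not_forall] at hcu
        exact ⟨u, ⟨i, hi'.mem_left⟩, hcu, i, hi'⟩
      · exact absurd (hH.dom u v (by rw [huv.1]; simp)).1 hcu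
    · simp only [f, if_neg hcu, if_neg hcv]
      exact .refl

open Classical in
theorem Valid.update_determinate (hn : 0 < n) (hσ : ∀ i, (σ i).Nodup) (hH : Valid σ H)
    (hC : InClass σ O k H)
    (hab : (a ∈ common σ ∧ b ∈ common σ ∧ a ≠ b) ∧ support σ a b = k)
    (h : H (some a, some b) = none)
    (hp : ¬ HasPath (neighborhood σ a b) (fun f => IsDet H f ∨ IsIndet H f) (some b) (some a)) :
    Valid σ (Function.update H (some a, some b) (some .determinate)) := by
  set H' := Function.update H (some a, some b) (some .determinate) with hH'
  have hold : ∀ e, H' e = H e ∨ e = (some a, some b) ∧ H' e = some .determinate := by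
    intro e
    by_cases he : e = (some a, some b)
    · subst he; exact Or.inr ⟨rfl, Function.update_self ..⟩
    · exact Or.inl (Function.update_of_ne he ..)
  have hmono : ∀ e D, H e = some D → H' e = some D := by
    intro e D he
    rcases hold e with h' | ⟨rfl, -⟩
    · rw [h', he]
    · rw [h] at he; simp at he
  have hexcl : ∀ e, IsExcluded H' e → IsExcluded H e := by
    intro e he
    rcases hold e with h' | ⟨rfl, h'⟩
    · exact h'.symm.trans he
    · rw [IsExcluded, h'] at he; simp at he
  have hindet : ∀ e, IsIndet H' e → IsIndet H e := by
    intro e he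
    rcases hold e with h' | ⟨rfl, h'⟩
    · exact h'.symm.trans he
    · rw [IsIndet, h'] at he; simp at he
  have hdet : ∀ e, IsDet H' e → IsDet H e ∨ e = (some a, some b) := by
    intro e he
    rcases hold e with h' | ⟨h', -⟩
    · exact Or.inl (h'.symm.trans he)
    · exact Or.inr h'
  have hdet' : ∀ x y, IsDet H' (some x, some y) → IsDet H (some x, some y) ∨ x = a ∧ y = b :=
    fun x y hxy => (hdet _ hxy).imp id fun h => by simpa using h
  have hsum := support_add_support hn hσ hab.1.1 hab.1.2.1 hab.1.2.2
  -- Only unanimity removes the endpoints `a` and `b` from `U_{a,b}`.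
  have hUa : k ≠ n → some a ∈ neighborhood σ a b := fun hk =>
    (some_mem_neighborhood hn).2 ⟨hab.1.1, fun h => absurd rfl h, fun _ => by omega⟩
  have hUb : k ≠ n → some b ∈ neighborhood σ a b := fun hk =>
    (some_mem_neighborhood hn).2 ⟨hab.1.2.1, fun _ => by omega, fun h => absurd rfl h⟩
  have hrev : k ≠ n → ¬ (IsDet H (some b, some a) ∨ IsIndet H (some b, some a)) := fun hk h' =>
    hp (.single ⟨hUb hk, hUa hk, h'⟩)
  refine ⟨?_, ?_, ?_, ?_, ?_, ?_, ?_, ?_, ?_, ?_, ?_⟩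
  · intro x y hxy
    rcases hold (some x, some y) with h' | ⟨h', -⟩
    · exact hH.dom x y (h' ▸ hxy)
    · simp only [Prod.mk.injEq, Option.some.injEq] at h'
      obtain ⟨rfl, rfl⟩ := h'
      exact hab.1
  · exact fun x y hxy => TransGen.mono (DetEdge.mono fun _ _ h => hmono _ _ h) _ _
      (hH.excluded_path x y (hexcl _ hxy))
  · intro x y hxy hlt
    refine hmono _ _ ?_
    rcases hdet' x y hxy with hxy | ⟨rfl, rfl⟩
    · exact hH.reverse x y hxy hlt
    -- The reverse edge is heavier, hence decided. In `H` it would be a forbidden path of length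
    -- one, so it is excluded.
    · have h4 := hC.decided y x hab.1.2.1 hab.1.1 hab.1.2.2.symm (by omega)
      have h5 := hrev (by omega)
      unfold IsDet IsIndet at h5
      rcases hd : H (some y, some x) with _ | D
      · exact absurd hd h4
      · cases D <;> simp_all
  · intro x y hxy hf
    rcases hdet' x y hxy with hxy | ⟨rfl, rfl⟩
    · exact hH.future x y hxy hf
    · by_contra hne
      rw [hab.2] at hne
      refine hp (.tail (.single ⟨hUb hne, none_mem_neighborhood, Or.inr ?_⟩)
        ⟨none_mem_neighborhood, hUa hne, Or.inr ?_⟩)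
      · exact (hC.to_future _).trans (initial_to_future hab.1.2.1)
      · exact (hC.from_future _).trans (initial_from_future.2 ⟨hab.1.1, hf⟩)
  · exact fun x y hxy => hH.excluded_ne x y (hexcl _ hxy)
  · exact fun x y hxy => hH.indet_ne x y (hindet _ hxy)
  · intro x y hxy hyx
    rcases hdet' y x hyx with hyx | ⟨rfl, rfl⟩
    · exact hH.antisymm x y (hindet _ hxy) hyx
    -- The reverse of a unanimous edge has support `0`, and its class is still open.
    · by_cases hk : k = n
      · have h4 := hC.not_indet x y
        have h5 := hC.le_support_of_ne_none (a := x) (b := y) (by rw [hindet _ hxy]; simp)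
        omega
      · exact hrev hk (Or.inr (hindet _ hxy))
  · exact fun x y hxy => (hH.deferred x y (hindet _ hxy)).mono (fun _ _ h => hmono _ _ h)
      fun _ h => hmono _ _ h
  · intro j hj
    by_cases hjk : j = k
    · subst hjk
      intro σ' G hσ' h₁ h₂ h₃ h₄
      have h₃' : ∀ a b, G a b → ¬ IsExcluded H (some a, some b) := fun x y hxy hx =>
        h₃ x y hxy (hmono _ _ hx)
      have hR := hH.insertable j hj σ' G hσ' h₁ h₂ h₃' h₄
      refine (hR.insert (hH.not_reflTransGen hn hσ hC hab.1 hp hσ' h₁ h₂ h₃' hR)).mono ?_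
      rintro x y (hxy | ⟨hxy, hs⟩)
      · exact Or.inl (Or.inl hxy)
      · exact (hdet' x y hxy).imp (fun h => Or.inr ⟨h, hs⟩) id
    · refine (hH.insertable j hj).congr (fun x y hs hxy => ?_) fun _ _ h => hmono _ _ h
      rcases hdet' x y hxy with hxy | ⟨rfl, rfl⟩
      · exact hxy
      · omega
  · exact fun x hx => hH.not_det_left x ((hdet _ hx).resolve_right (by simp))
  · exact fun x hx => hH.not_det_right x ((hdet _ hx).resolve_right (by simp))

open Classical in
theorem visit_cases (σ : Fin n → List Tx) (H : Decisions Tx) (e : Tx × Tx) :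
    visit σ H e = H ∨ H (toEdge e) = none ∧
      (HasPath (neighborhood σ e.1 e.2) (IsDet H) (some e.2) (some e.1) ∧
        visit σ H e = Function.update H (toEdge e) (some .excluded) ∨
      ¬ HasPath (neighborhood σ e.1 e.2) (fun f => IsDet H f ∨ IsIndet H f)
          (some e.2) (some e.1) ∧
        visit σ H e = Function.update H (toEdge e) (some .determinate)) := by
  unfold visit
  split_ifs with h h₁ h₂
  · exact Or.inl rfl
  · exact Or.inr ⟨not_not.1 h, Or.inl ⟨h₁, rfl⟩⟩
  · exact Or.inl rfl
  · exact Or.inr ⟨not_not.1 h, Or.inr ⟨h₂, rfl⟩⟩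

theorem visit_valid (hn : 0 < n) (hσ : ∀ i, (σ i).Nodup) {e : Tx × Tx} (he : e ∈ weightClass σ k)
    (hH : Valid σ H) (hC : InClass σ O k H) :
    Valid σ (visit σ H e) ∧ InClass σ O k (visit σ H e) := by
  obtain ⟨a, b⟩ := e
  have hab := (mem_weightClass hn).1 he
  rcases visit_cases σ H (a, b) with h | ⟨h, ⟨hp, h'⟩ | ⟨hp, h'⟩⟩
  · rw [h]
    exact ⟨hH, hC⟩
  · rw [h']
    exact ⟨hH.update_excluded hn hC hab h hp, hC.update hab.2 h (by simp)⟩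
  · rw [h']
    exact ⟨hH.update_determinate hn hσ hC hab h hp, hC.update hab.2 h (by simp)⟩

end Visit

/-! ### Repeated passes -/

section Passes

variable {σ : Fin n → List Tx} {O H : Decisions Tx} {k : ℕ} {es : List (Tx × Tx)}

open Classical in
/-- The number of edges in `es` that are still open. -/
noncomputable def openCount (es : List (Tx × Tx)) (H : Decisions Tx) : ℕ :=
  (es.toFinset.filter fun p => H (toEdge p) = none).card

theorem openCount_le (es : List (Tx × Tx)) (H : Decisions Tx) : openCount es H ≤ es.length := by
  classical
  exact (Finset.card_filter_le _ _).trans es.toFinset_card_le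

theorem openCount_visit {e : Tx × Tx} (he : e ∈ es) :
    visit σ H e = H ∨ openCount es (visit σ H e) < openCount es H := by
  classical
  refine (visit_cases σ H e).imp id ?_
  rintro ⟨h, h'⟩
  obtain ⟨D, h'⟩ : ∃ D, visit σ H e = Function.update H (toEdge e) (some D) := by
    rcases h' with h' | h' <;> exact ⟨_, h'.2⟩
  rw [h']
  refine Finset.card_lt_card (Finset.ssubset_iff_of_subset (fun p hp => ?_) |>.2 ⟨e, ?_, ?_⟩)
  · rw [Finset.mem_filter] at hp ⊢
    refine ⟨hp.1, ?_⟩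
    by_cases hpe : toEdge p = toEdge e
    · rw [hpe, h]
    · rw [← hp.2, Function.update_of_ne hpe]
  · simp [he, h]
  · simp

theorem openCount_foldl {es' : List (Tx × Tx)} (h : ∀ e ∈ es', e ∈ es) :
    (es'.foldl (visit σ) H = H ∧ ∀ e ∈ es', visit σ H e = H) ∨
      openCount es (es'.foldl (visit σ) H) < openCount es H := by
  induction es' generalizing H with
  | nil => simp
  | cons e l ih =>
    rw [List.foldl_cons]
    have hl := @ih (visit σ H e) fun x hx => h x (List.mem_cons_of_mem _ hx)
    rcases openCount_visit (σ := σ) (H := H) (h e (List.mem_cons_self ..)) with h₁ | h₁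
    · rw [h₁] at hl ⊢
      refine hl.imp (fun hl => ⟨hl.1, fun x hx => ?_⟩) id
      rcases List.mem_cons.1 hx with rfl | hx
      · exact h₁
      · exact hl.2 x hx
    · refine Or.inr ?_
      rcases hl with hl | hl
      · rw [hl.1]; exact h₁
      · exact hl.trans h₁

/-- Each application that changes the state lowers `m`, which can happen at most `m x` times. -/
theorem iterate_fixed_of_lt {α : Type*} {f : α → α} {m : α → ℕ}
    (hf : ∀ x, f x = x ∨ m (f x) < m x) (N : ℕ) (x : α) (hN : m x ≤ N) :
    f (f^[N] x) = f^[N] x := by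
  induction N generalizing x with
  | zero => exact (hf x).resolve_right (by omega)
  | succ N ih =>
    rw [Function.iterate_succ_apply]
    rcases hf x with h | h
    · rw [h, Function.iterate_fixed h, h]
    · exact ih _ (by omega)

/-- After as many passes as there are edges, no visit changes the state. -/
theorem visit_passes {e : Tx × Tx} (he : e ∈ es) :
    visit σ ((fun H' => es.foldl (visit σ) H')^[es.length] H) e =
      (fun H' => es.foldl (visit σ) H')^[es.length] H := by
  have hfix := iterate_fixed_of_lt (f := fun H' => es.foldl (visit σ) H') (m := openCount es)
    (fun H' => (openCount_foldl (σ := σ) (H := H') fun _ h => h).imp And.left id) es.length H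
    (openCount_le es H)
  rcases openCount_foldl (σ := σ) (H := (fun H' => es.foldl (visit σ) H')^[es.length] H)
    (es := es) fun _ h => h with h | h
  · exact h.2 e he
  · exact absurd (congrArg (openCount es) hfix) h.ne

theorem foldl_visit_valid (hn : 0 < n) (hσ : ∀ i, (σ i).Nodup)
    (hes : ∀ e ∈ es, e ∈ weightClass σ k) (h : Valid σ H ∧ InClass σ O k H) :
    Valid σ (es.foldl (visit σ) H) ∧ InClass σ O k (es.foldl (visit σ) H) := by
  induction es generalizing H with
  | nil => exact h
  | cons e l ih =>
    exact ih (fun x hx => hes x (List.mem_cons_of_mem _ hx))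
      (visit_valid hn hσ (hes e (List.mem_cons_self ..)) h.1 h.2)

theorem passes_valid (hn : 0 < n) (hσ : ∀ i, (σ i).Nodup)
    (hes : ∀ e ∈ es, e ∈ weightClass σ k) (h : Valid σ H ∧ InClass σ O k H) (N : ℕ) :
    Valid σ ((fun H' => es.foldl (visit σ) H')^[N] H) ∧
      InClass σ O k ((fun H' => es.foldl (visit σ) H')^[N] H) := by
  induction N generalizing H with
  | zero => exact h
  | succ N ih => exact ih (foldl_visit_valid hn hσ hes h)

open Classical in
theorem hasPath_of_visit_eq {e : Tx × Tx} (h : visit σ H e = H) (ho : H (toEdge e) = none) :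
    ¬ HasPath (neighborhood σ e.1 e.2) (IsDet H) (some e.2) (some e.1) ∧
      HasPath (neighborhood σ e.1 e.2) (fun f => IsDet H f ∨ IsIndet H f) (some e.2) (some e.1) := by
  have hne : ∀ D, Function.update H (toEdge e) (some D) ≠ H := fun D hD => by
    have := congrFun hD (toEdge e)
    rw [Function.update_self, ho] at this
    simp at this
  unfold visit at h
  split_ifs at h with h₀ h₁ h₂
  · exact absurd ho h₀
  · exact absurd h (hne _)
  · exact ⟨h₁, h₂⟩
  · exact absurd h (hne _)

end Passes

/-! ### Marking the deferred edges -/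

section MarkRest

variable {σ : Fin n → List Tx} {O H : Decisions Tx} {k : ℕ} {es : List (Tx × Tx)}

/-- Take the last indeterminate edge of the path. It is heavier than `k` or starts at the future
vertex, since class `k` has no indeterminate edges yet and lighter classes are open. -/
theorem deferred_of_hasPath (hH : Valid σ H) (hC : InClass σ O k H) {a b : Tx}
    (hk : support σ a b = k)
    (h₁ : ¬ HasPath (neighborhood σ a b) (IsDet H) (some b) (some a))
    (h₂ : HasPath (neighborhood σ a b) (fun f => IsDet H f ∨ IsIndet H f) (some b) (some a)) :
    Deferred σ H a b := by
  have h₃ := transGen_or_cases (R := fun u v => u ∈ neighborhood σ a b ∧ v ∈ neighborhood σ a b ∧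
    IsDet H (u, v)) (S := fun u v => u ∈ neighborhood σ a b ∧ v ∈ neighborhood σ a b ∧
    IsIndet H (u, v)) (TransGen.mono (fun u v h => by tauto) _ _ h₂)
  rcases h₃ with h₃ | ⟨c, d, hc, hd⟩
  · exact absurd h₃ h₁
  · obtain ⟨d, rfl, hd'⟩ :=
      hH.exists_some_of_reflTransGen (s := 0) (fun _ _ _ => Nat.zero_le _) hd
    refine ⟨c, d, hc.2.2, ?_, hc.2.1, hd'⟩
    rintro c rfl
    have h₄ := hC.le_support_of_ne_none (a := c) (b := d) (by rw [hc.2.2]; simp)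
    have h₅ : support σ c d ≠ k := fun h => hC.not_indet c d h hc.2.2
    omega

theorem markRest_cases (es : List (Tx × Tx)) (H : Decisions Tx) (e : Option Tx × Option Tx) :
    markRest es H e = H e ∨ (∃ p ∈ es, e = toEdge p) ∧ H e = none ∧
      markRest es H e = some .indeterminate := by
  unfold markRest
  split_ifs with h
  · exact Or.inr ⟨h.1, h.2, rfl⟩
  · exact Or.inl rfl

theorem markRest_valid (hn : 0 < n) (hσ : ∀ i, (σ i).Nodup)
    (hes : ∀ e, e ∈ es ↔ e ∈ weightClass σ k) (hH : Valid σ H)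
    (hC : InClass σ O k H) (hfix : ∀ e ∈ es, visit σ H e = H) :
    Valid σ (markRest es H) ∧ Progress σ O k (markRest es H) := by
  set H' := markRest es H with hH'
  have hcases : ∀ a b, H' (some a, some b) = H (some a, some b) ∨
      (a, b) ∈ es ∧ H (some a, some b) = none ∧ H' (some a, some b) = some .indeterminate := by
    intro a b
    refine (markRest_cases es H (some a, some b)).imp id fun h => ⟨?_, h.2⟩
    obtain ⟨p, hp, he⟩ := h.1
    rwa [toEdge_injective (p := (a, b)) he]
  have hto : ∀ x, H' (x, none) = H (x, none) := fun x => by simp [hH', markRest, toEdge]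
  have hfrom : ∀ x, H' (none, x) = H (none, x) := fun x => by simp [hH', markRest, toEdge]
  have hmono : ∀ e D, H e = some D → H' e = some D := by
    intro e D he
    rcases markRest_cases es H e with h' | ⟨-, h', -⟩
    · rw [hH', h', he]
    · rw [h'] at he; simp at he
  have hdet : ∀ e, IsDet H' e → IsDet H e := by
    intro e he
    rcases markRest_cases es H e with h' | ⟨-, -, h'⟩
    · exact h'.symm.trans he
    · rw [IsDet, hH', h'] at he; simp at he
  have hexcl : ∀ e, IsExcluded H' e → IsExcluded H e := by
    intro e he
    rcases markRest_cases es H e with h' | ⟨-, -, h'⟩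
    · exact h'.symm.trans he
    · rw [IsExcluded, hH', h'] at he; simp at he
  have hindet : ∀ a b, IsIndet H' (some a, some b) → IsIndet H (some a, some b) ∨
      ((a ∈ common σ ∧ b ∈ common σ ∧ a ≠ b) ∧ support σ a b = k) ∧
      ¬ HasPath (neighborhood σ a b) (IsDet H) (some b) (some a) ∧
      HasPath (neighborhood σ a b) (fun f => IsDet H f ∨ IsIndet H f) (some b) (some a) := by
    intro a b h
    rcases hcases a b with h' | ⟨h₁, h₂, -⟩
    · exact Or.inl (h'.symm.trans h)
    · exact Or.inr ⟨(mem_weightClass hn).1 ((hes _).1 h₁), hasPath_of_visit_eq (hfix _ h₁) h₂⟩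
  refine ⟨⟨?_, ?_, ?_, ?_, ?_, ?_, ?_, ?_, ?_, ?_, ?_⟩, ⟨?_, ?_, ?_, ?_, ?_⟩⟩
  · intro a b h
    rcases hcases a b with h' | ⟨h₁, -⟩
    · exact hH.dom a b (h' ▸ h)
    · exact ((mem_weightClass hn).1 ((hes _).1 h₁)).1
  · exact fun x y hxy => TransGen.mono (DetEdge.mono fun _ _ h => hmono _ _ h) _ _
      (hH.excluded_path x y (hexcl _ hxy))
  · exact fun x y hxy hlt => hmono _ _ (hH.reverse x y (hdet _ hxy) hlt)
  · exact fun x y hxy => hH.future x y (hdet _ hxy)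
  · exact fun x y hxy => hH.excluded_ne x y (hexcl _ hxy)
  · intro a b h
    rcases hindet a b h with h | ⟨h₁, -, h₂⟩
    · exact hH.indet_ne a b h
    · exact h₂.support_ne hn h₁.1.2.2
  · intro a b h hd
    rcases hindet a b h with h | ⟨h₁, h₂, h₃⟩
    · exact hH.antisymm a b h (hdet _ hd)
    · have h₄ := h₃.support_ne hn h₁.1.2.2
      have hsum := support_add_support hn hσ h₁.1.1 h₁.1.2.1 h₁.1.2.2
      -- A determinate reverse edge would be a determinate path from `b` to `a`, and `(a, b)` would
      -- have been excluded.
      refine h₂ (.single ⟨?_, ?_, hdet _ hd⟩)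
      · exact (some_mem_neighborhood hn).2
          ⟨h₁.1.2.1, fun _ => by omega, fun h => absurd rfl h⟩
      · exact (some_mem_neighborhood hn).2 ⟨h₁.1.1, fun h => absurd rfl h, fun _ => h₄⟩
  · intro a b h
    refine Deferred.mono (H := H) (fun _ _ h => hmono _ _ h) (fun _ h => hmono _ _ h) ?_
    rcases hindet a b h with h | ⟨h₁, h₂, h₃⟩
    · exact hH.deferred a b h
    · exact deferred_of_hasPath hH hC h₁.2 h₂ h₃
  · exact fun j hj => (hH.insertable j hj).congr (fun _ _ _ h => hdet _ h) fun _ _ h => hmono _ _ h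
  · exact fun x hx => hH.not_det_left x (hdet _ hx)
  · exact fun x hx => hH.not_det_right x (hdet _ hx)
  · exact fun x => (hto x).trans (hC.to_future x)
  · exact fun x => (hfrom x).trans (hC.from_future x)
  · intro a b ha hb hab hs
    rcases hs.eq_or_lt with hs | hs
    · have hm : (a, b) ∈ es := (hes _).2 ((mem_weightClass hn).2 ⟨⟨ha, hb, hab⟩, hs.symm⟩)
      rw [hH', markRest]
      split_ifs with h
      · simp
      · exact fun h' => h ⟨⟨_, hm, rfl⟩, h'⟩
    · have := hC.decided a b ha hb hab hs
      rcases hcases a b with h' | ⟨-, h₁, -⟩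
      · rwa [h']
      · exact absurd h₁ this
  · intro a b hs
    rcases hcases a b with h' | ⟨h₁, -⟩
    · rw [h', hC.undecided a b hs]
    · have := ((mem_weightClass hn).1 ((hes _).1 h₁)).2
      omega
  · intro a b hs ho
    have h₁ := hC.oracle a b hs ho
    rcases hcases a b with h' | ⟨-, h₂, -⟩
    · rw [h', h₁]
    · rw [h₂] at h₁
      rcases ho with ho | ho <;> rw [ho] at h₁ <;> simp at h₁

end MarkRest

/-! ### Invocations -/

section Invoke

variable {σ₀ σ : Fin n → List Tx} {O H : Decisions Tx}
  {ord : Finset (Tx × Tx) → List (Tx × Tx)}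

theorem processClass_valid (hn : 0 < n) (hord : ∀ s e, e ∈ ord s ↔ e ∈ s) {k : ℕ}
    (hσ : Extends σ₀ σ) (hO : Valid σ₀ O) (hH : Valid σ H) (hP : Progress σ O (k + 1) H) :
    Valid σ (processClass ord O σ H k) ∧ Progress σ O k (processClass ord O σ H k) := by
  have hes := hord (weightClass σ k)
  have h := passes_valid hn (fun i => (hσ i).2) (fun e => (hes e).1)
    ⟨consultOracle_valid hn hes hσ hO hH hP, consultOracle_inClass hn hes hσ hO hP⟩
    (ord (weightClass σ k)).length
  exact markRest_valid hn (fun i => (hσ i).2) hes h.1 h.2 fun e he => visit_passes he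

theorem invoke_valid (hn : 0 < n) (hord : ∀ s e, e ∈ ord s ↔ e ∈ s)
    (hσ : Extends σ₀ σ) (hO : Valid σ₀ O) :
    Valid σ (invoke ord O σ) ∧ Progress σ O 0 (invoke ord O σ) := by
  have key : ∀ m H, Valid σ H ∧ Progress σ O m H →
      Valid σ ((List.range m).reverse.foldl (processClass ord O σ) H) ∧
        Progress σ O 0 ((List.range m).reverse.foldl (processClass ord O σ) H) := by
    intro m
    induction m with
    | zero => exact fun H h => h
    | succ m ih =>
      intro H h
      rw [List.range_succ, List.reverse_append, List.reverse_singleton, List.singleton_append,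
        List.foldl_cons]
      exact ih _ (processClass_valid hn hord hσ hO h.1 h.2)
  exact key (n + 1) _ ⟨valid_initial σ, progress_initial σ O⟩

theorem runs_valid (hn : 0 < n) (hord : ∀ s e, e ∈ ord s ↔ e ∈ s)
    (past : List (Fin n → List Tx)) (hpast : (past ++ [σ]).Pairwise Extends)
    (hσ : ∀ i, (σ i).Nodup) (hnd : ∀ σ' ∈ past, ∀ i, (σ' i).Nodup) :
    ∃ O, Valid σ (runs ord (past ++ [σ])) ∧ Progress σ O 0 (runs ord (past ++ [σ])) := by
  have key : ∀ (l : List (Fin n → List Tx)) (σ₀ : Fin n → List Tx) (O : Decisions Tx),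
      (σ₀ :: (l ++ [σ])).Pairwise Extends → Valid σ₀ O →
      ∃ O', Valid σ ((l ++ [σ]).foldl (invoke ord) O) ∧
        Progress σ O' 0 ((l ++ [σ]).foldl (invoke ord) O) := by
    intro l
    induction l with
    | nil =>
      intro σ₀ O h hO
      exact ⟨O, invoke_valid hn hord ((List.pairwise_cons.1 h).1 σ (by simp)) hO⟩
    | cons σ₁ l ih =>
      intro σ₀ O h hO
      rw [List.cons_append, List.pairwise_cons] at h
      exact ih σ₁ _ h.2 (invoke_valid hn hord (h.1 σ₁ (by simp)) hO).1
  unfold runs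
  rcases past with _ | ⟨σ₁, l⟩
  -- The empty oracle is valid for every profile, so the first profile can serve as its own
  -- predecessor.
  · exact ⟨_, invoke_valid hn hord (Extends.refl hσ) (valid_empty σ)⟩
  · refine key (σ₁ :: l) σ₁ _ (List.pairwise_cons.2 ⟨?_, hpast⟩) (valid_empty σ₁)
    intro σ' h
    rcases List.mem_cons.1 h with rfl | h
    · exact Extends.refl (hnd _ (by simp))
    · exact (List.pairwise_cons.1 hpast).1 σ' h

end Invoke

/-! ### The final state -/

section Final

variable {σ : Fin n → List Tx} {O H : Decisions Tx}

theorem acyclic_precedes {v : List Tx} (hv : v.Nodup) : Acyclic (Precedes v) := by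
  intro x hx
  have : ∀ y, TransGen (Precedes v) x y → Precedes v x y := by
    intro y hy
    induction hy with
    | single h => exact h
    | tail _ h ih => exact ih.trans hv h
  exact (this x hx).ne hv rfl

theorem Valid.det_of_unanimous (hH : Valid σ H) (hP : Progress σ O 0 H) {a b : Tx}
    (ha : a ∈ common σ) (hb : b ∈ common σ) (hab : a ≠ b) (h : support σ a b = n) :
    IsDet H (some a, some b) := by
  have h₁ := hP.decided a b ha hb hab (Nat.zero_le _)
  rcases hd : H (some a, some b) with _ | (_ | _ | _)
  · exact absurd hd h₁
  · exact hd
  · exact absurd h (hH.indet_ne a b hd)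
  · exact absurd h (hH.excluded_ne a b hd)

/-- Unanimous edges follow the vote of one replica. Lighter classes are added in descending order,
each by `Insertable` with the profile itself as the later one. -/
theorem Valid.acyclic (hn : 0 < n) (hσ : ∀ i, (σ i).Nodup) (hH : Valid σ H)
    (hP : Progress σ O 0 H) : Acyclic (DetEdge σ H 0) := by
  have key : ∀ m, Acyclic (DetEdge σ H (n - m)) := by
    intro m
    induction m with
    | zero =>
      refine (acyclic_precedes (hσ ⟨0, hn⟩)).mono fun a b h => ?_
      exact support_eq_card_iff.1 (le_antisymm (support_le σ a b) (by simpa using h.2)) _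
    | succ m ih =>
      by_cases hm : m < n
      · refine (hH.insertable (n - (m + 1)) (by omega) σ (DetEdge σ H (n - m)) (Extends.refl hσ)
          (fun a b h => ⟨hH.dom a b (by rw [h.1]; simp), by have := h.2; omega⟩)
          (fun a b ha hb hab h => ⟨hH.det_of_unanimous hP ha hb hab h, by omega⟩)
          (fun a b h hx => ?_) ih).mono fun a b h => ?_
        · rw [IsExcluded, h.1] at hx
          simp at hx
        · by_cases hs : support σ a b = n - (m + 1)
          · exact Or.inr ⟨h.1, hs⟩
          · exact Or.inl ⟨h.1, by have := h.2; omega⟩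
      · rwa [show n - (m + 1) = n - m by omega]
  simpa using key n

theorem Valid.futurePrecedes_of_path (hσ : ∀ i, (σ i).Nodup) (hH : Valid σ H) {a d : Tx}
    (h : ReflTransGen (DetEdge σ H 0) d a) (hd : FuturePrecedes σ d) : FuturePrecedes σ a := by
  induction h with
  | refl => exact hd
  | tail _ h ih => exact futurePrecedes_of_unanimous hσ (hH.future _ _ h.1 ih) ih

theorem FuturePrecedes.two_le {a : Tx} (h : FuturePrecedes σ a) : 2 ≤ n := by
  obtain ⟨y, ⟨i, hi⟩, ⟨j, hj⟩, -⟩ := h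
  by_contra hn
  have : i = j := Fin.ext (by omega)
  exact hj (this ▸ hi)

end Final

/-! ### Bounds on sending times -/

section Time

variable {X : Execution n Tx} {Δ T : ℝ} {O H : Decisions Tx} {a b d τ : Tx} {i : Fin n}

theorem Execution.DelayBound.nonneg (hn : 0 < n) (hΔ : X.DelayBound Δ) (τ : Tx) : 0 ≤ Δ := by
  have := X.causal _ ⟨0, hn⟩ τ (hΔ τ _)
  linarith

theorem Execution.DelayBound.mem_common (hn : 0 < n) (hΔ : X.DelayBound Δ)
    (h : X.sent τ + Δ ≤ T) : τ ∈ common (X.vote T) :=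
  (StreamingRankedPairs.mem_common hn).2 fun i => (X.extend _ _ i h).subset (hΔ τ i)

/-- By time `X.sent b + Δ` the vote contains `b`, hence also everything before it, which must have
been sent by then. -/
theorem Execution.DelayBound.sent_le_of_precedes (hΔ : X.DelayBound Δ)
    (h : Precedes (X.vote T i) a b) : X.sent a ≤ X.sent b + Δ := by
  rcases le_total (X.sent b + Δ) T with hT | hT
  · exact X.causal _ i a (h.of_extension (X.extend _ _ i hT) (X.nodup T i) (hΔ b i)).mem_left
  · exact (X.causal T i a h.mem_left).trans hT

theorem Execution.DelayBound.unanimous (hn : 0 < n) (hΔ : X.DelayBound Δ)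
    (ha : a ∈ common (X.vote T)) (hb : b ∈ common (X.vote T)) (h : X.sent a + Δ < X.sent b) :
    a ≠ b ∧ support (X.vote T) a b = n := by
  have hne : a ≠ b := by
    rintro rfl
    have := hΔ.nonneg hn a
    linarith
  refine ⟨hne, support_eq_card_iff.2 fun i => ?_⟩
  rw [StreamingRankedPairs.mem_common hn] at ha hb
  refine (precedes_or_precedes (ha i) (hb i) hne).resolve_right fun hba => ?_
  have := hΔ.sent_le_of_precedes hba
  linarith

/-- A transaction still missing from a vote was sent after `T - Δ`; preceding `a` in some vote costs
another `Δ`. -/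
theorem Execution.DelayBound.sent_gt_of_futurePrecedes (hΔ : X.DelayBound Δ)
    (h : FuturePrecedes (X.vote T) a) : T - 2 * Δ < X.sent a := by
  obtain ⟨y, -, ⟨j, hj⟩, i, hi⟩ := h
  have h₁ := hΔ.sent_le_of_precedes hi
  have h₂ : T < X.sent y + Δ := by
    by_contra hT
    exact hj ((X.extend _ _ j (not_lt.1 hT)).subset (hΔ y j))
  linarith

theorem Execution.DelayBound.sent_le_of_mem_neighborhood (hn : 0 < n) (hΔ : X.DelayBound Δ)
    (h : some d ∈ neighborhood (X.vote T) a b) : X.sent d ≤ X.sent a + Δ := by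
  by_cases hda : d = a
  · subst hda
    have := hΔ.nonneg hn d
    linarith
  · obtain ⟨i, hi⟩ := support_pos_iff.1
      (Nat.pos_of_ne_zero (((some_mem_neighborhood hn).1 h).2.1 hda))
    exact hΔ.sent_le_of_precedes hi

theorem Progress.indet_from_future {σ : Fin n → List Tx} (hP : Progress σ O 0 H)
    (h : IsIndet H (none, some a)) : a ∈ common σ ∧ FuturePrecedes σ a :=
  initial_from_future.1 ((hP.from_future _).symm.trans h)

/-- The head of an indeterminate edge was sent recently if all but few replicas support the edge. -/
theorem sent_gt_of_isIndet (hn : 0 < n) (hΔ : X.DelayBound Δ) (hH : Valid (X.vote T) H)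
    (hP : Progress (X.vote T) O 0 H) (m : ℕ) (a b : Tx) (hab : IsIndet H (some a, some b))
    (hm : n ≤ support (X.vote T) a b + m) (hpos : 0 < support (X.vote T) a b) :
    T - (2 * m + 1) * Δ < X.sent b := by
  have hΔ₀ := hΔ.nonneg hn a
  induction m generalizing a b with
  | zero => exact absurd (le_antisymm (support_le _ a b) hm) (hH.indet_ne a b hab)
  | succ m ih =>
    obtain ⟨i, hi⟩ := support_pos_iff.1 hpos
    have h₁ := hΔ.sent_le_of_precedes hi
    obtain ⟨c, d, hcd, hs, hd, hpath⟩ := hH.deferred a b hab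
    push_cast
    rcases c with _ | c
    -- Determinate edges out of a transaction with a future predecessor are unanimous, so this
    -- property passes from `d` to `a`.
    · have hf := hH.futurePrecedes_of_path (X.nodup T) hpath (hP.indet_from_future hcd).2
      have := hΔ.sent_gt_of_futurePrecedes hf
      have : 0 ≤ (m : ℝ) * Δ := by positivity
      linarith
    -- One `Δ` is lost from `d` to `a`, as `d` lies in `U_{a,b}`, and one from `a` to `b`, as some
    -- vote has `a` before `b`.
    · have h₂ := hs c rfl
      have h₃ := ih c d hcd (by omega) (by omega)
      have h₄ := hΔ.sent_le_of_mem_neighborhood hn hd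
      linarith

/-- The source of the constant `n + 1`: `T - n * Δ` is at least `X.sent τ + Δ`, so the edge from `τ`
to `d` is unanimous. -/
theorem path_of_sent_gt (hn : 0 < n) (hΔ : X.DelayBound Δ) (hH : Valid (X.vote T) H)
    (hP : Progress (X.vote T) O 0 H) (hτ : X.sent τ + ((n : ℝ) + 1) * Δ ≤ T)
    (hd : d ∈ common (X.vote T)) (h : T - n * Δ < X.sent d) :
    TransGen (DetEdge (X.vote T) H 0) τ d := by
  have hΔ₀ := hΔ.nonneg hn τ
  have hnΔ : 0 ≤ (n : ℝ) * Δ := by positivity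
  have hc : τ ∈ common (X.vote T) := hΔ.mem_common hn (by linarith)
  obtain ⟨hne, hs⟩ := hΔ.unanimous hn hc hd (by linarith)
  exact .single ⟨hH.det_of_unanimous hP hc hd hne hs, Nat.zero_le _⟩

/-- The head was sent after `T - 2 * Δ`, and `2 ≤ n` because one vote has a transaction that another
lacks. -/
theorem path_of_indet_from_future (hn : 0 < n) (hΔ : X.DelayBound Δ) (hH : Valid (X.vote T) H)
    (hP : Progress (X.vote T) O 0 H) (hτ : X.sent τ + ((n : ℝ) + 1) * Δ ≤ T)
    (h : IsIndet H (none, some d)) : TransGen (DetEdge (X.vote T) H 0) τ d := by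
  obtain ⟨hd, hf⟩ := hP.indet_from_future h
  refine path_of_sent_gt hn hΔ hH hP hτ hd ?_
  have h₁ := hΔ.sent_gt_of_futurePrecedes hf
  have h₂ : (2 : ℝ) ≤ n := by exact_mod_cast hf.two_le
  have := mul_le_mul_of_nonneg_right h₂ (hΔ.nonneg hn τ)
  linarith

theorem path_to_tail (hn : 0 < n) (hΔ : X.DelayBound Δ) (hH : Valid (X.vote T) H)
    (hP : Progress (X.vote T) O 0 H) (hτ : X.sent τ + ((n : ℝ) + 1) * Δ ≤ T)
    (hab : IsIndet H (some a, some b))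
    (h : ∀ c d, IsIndet H (some c, some d) →
      support (X.vote T) a b < support (X.vote T) c d → TransGen (DetEdge (X.vote T) H 0) τ d) :
    TransGen (DetEdge (X.vote T) H 0) τ a := by
  obtain ⟨c, d, hcd, hs, -, hpath⟩ := hH.deferred a b hab
  refine TransGen.trans_left ?_ hpath
  rcases c with _ | c
  · exact path_of_indet_from_future hn hΔ hH hP hτ hcd
  · exact h c d hcd (hs c rfl)

theorem path_to_head (hn : 0 < n) (hΔ : X.DelayBound Δ) (hH : Valid (X.vote T) H)
    (hP : Progress (X.vote T) O 0 H) (hτ : X.sent τ + ((n : ℝ) + 1) * Δ ≤ T) (m : ℕ) (a b : Tx)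
    (hab : IsIndet H (some a, some b)) (hm : n ≤ support (X.vote T) a b + m) :
    TransGen (DetEdge (X.vote T) H 0) τ b := by
  induction m generalizing a b with
  | zero => exact absurd (le_antisymm (support_le _ a b) hm) (hH.indet_ne a b hab)
  | succ m ih =>
    have hdom := hH.dom a b (by rw [hab]; simp)
    have hsum := support_add_support hn (X.nodup T) hdom.1 hdom.2.1 hdom.2.2
    by_cases hk : n < 2 * support (X.vote T) a b
    · have h₁ := sent_gt_of_isIndet hn hΔ hH hP (support (X.vote T) b a) a b hab
        (by omega) (by omega)
      refine path_of_sent_gt hn hΔ hH hP hτ hdom.2.1 ?_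
      -- The votes missing from a strict majority edge are those for its reverse, fewer than half.
      have h₂ : (2 * support (X.vote T) b a + 1 : ℝ) ≤ n := by
        have : 2 * support (X.vote T) b a + 1 ≤ n := by omega
        exact_mod_cast this
      have := mul_le_mul_of_nonneg_right h₂ (hΔ.nonneg hn τ)
      linarith
    · have h₁ := hP.decided b a hdom.2.1 hdom.1 hdom.2.2.symm (Nat.zero_le _)
      rcases hd : H (some b, some a) with _ | (_ | _ | _)
      · exact absurd hd h₁
      · exact absurd hd (hH.antisymm a b hab)
      -- Here `b` is the tail of `(b, a)`, which is at least as heavy as `(a, b)`; so the causes of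
      -- its deferral are strictly heavier than `(a, b)` and fall under the induction hypothesis.
      · exact path_to_tail hn hΔ hH hP hτ hd fun c d hcd hs => ih c d hcd (by omega)
      · have h₂ := path_to_tail hn hΔ hH hP hτ hab fun c d hcd hs => ih c d hcd (by omega)
        exact h₂.trans (TransGen.mono (fun _ _ h => ⟨h.1, Nat.zero_le _⟩) _ _
          (hH.excluded_path b a hd))

/-- Every transaction that borders an indeterminate edge comes after those sent long ago. -/
theorem path_of_borders (hn : 0 < n) (hΔ : X.DelayBound Δ) (hH : Valid (X.vote T) H)
    (hP : Progress (X.vote T) O 0 H) (hτ : X.sent τ + ((n : ℝ) + 1) * Δ ≤ T) {x : Tx}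
    (hx : Borders H x) : TransGen (DetEdge (X.vote T) H 0) τ x := by
  have hhead : ∀ a b, IsIndet H (some a, some b) → TransGen (DetEdge (X.vote T) H 0) τ b :=
    fun a b hab => path_to_head hn hΔ hH hP hτ n a b hab (by omega)
  rcases hx with hx | ⟨y, hx | hx⟩
  · exact path_of_indet_from_future hn hΔ hH hP hτ hx
  · exact path_to_tail hn hΔ hH hP hτ hx fun c d hcd _ => hhead c d hcd
  · exact hhead y x hx

theorem IsTopologicalSort.precedes_of_path {σ : Fin n → List Tx} {L : List Tx} (hH : Valid σ H)
    (hL : IsTopologicalSort (common σ) H L) {x y : Tx} (h : TransGen (DetEdge σ H 0) x y) :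
    Precedes L x y := by
  have hedge : ∀ a b, DetEdge σ H 0 a b → Precedes L a b := fun a b h =>
    have hd := hH.dom a b (by rw [h.1]; simp)
    hL.2.2 a hd.1 b hd.2.1 h.1
  induction h with
  | single h => exact hedge _ _ h
  | tail _ h ih => exact ih.trans hL.1 (hedge _ _ h)

end Time

end StreamingRankedPairs

theorem mainTheorem4 {Tx : Type*} {n : ℕ} (hn : 0 < n)
    (ord : Finset (Tx × Tx) → List (Tx × Tx))
    (hord : ∀ s, (ord s).Nodup ∧ ∀ e, e ∈ ord s ↔ e ∈ s)
    (X : StreamingRankedPairs.Execution n Tx) (Δ : ℝ) (hΔ : X.DelayBound Δ)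
    (past : List ℝ) (T : ℝ) (hpast : (past ++ [T]).Pairwise (· ≤ ·))
    (τ : Tx) (hτ : X.sent τ + ((n : ℝ) + 1) * Δ ≤ T) :
    (∃ out, StreamingRankedPairs.IsOutput ord (past.map X.vote) (X.vote T) out) ∧
      ∀ out, StreamingRankedPairs.IsOutput ord (past.map X.vote) (X.vote T) out → τ ∈ out := by
  have hext : (past.map X.vote ++ [X.vote T]).Pairwise StreamingRankedPairs.Extends := by
    rw [← List.map_singleton, ← List.map_append, List.pairwise_map]
    exact hpast.imp fun h i => ⟨X.extend _ _ i h, X.nodup _ i⟩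
  obtain ⟨O, hH, hP⟩ := StreamingRankedPairs.runs_valid hn (fun s => (hord s).2) _ hext
    (X.nodup T) (by
      intro σ' h i
      obtain ⟨t, -, rfl⟩ := List.mem_map.1 h
      exact X.nodup t i)
  refine ⟨?_, ?_⟩
  · obtain ⟨L, h₁, h₂, h₃⟩ := (hH.acyclic hn (X.nodup T) hP).exists_sort
      (StreamingRankedPairs.common (X.vote T))
    exact ⟨_, L, ⟨h₁, h₂, fun a ha b hb hab => h₃ a ha b hb ⟨hab, Nat.zero_le _⟩⟩, rfl⟩
  · rintro out ⟨L, hL, rfl⟩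
    have hΔ₀ := hΔ.nonneg hn τ
    have hnΔ : 0 ≤ (n : ℝ) * Δ := by positivity
    refine StreamingRankedPairs.mem_takeWhile_of_precedes
      ((hL.2.1 τ).2 (hΔ.mem_common hn (by linarith))) fun x hx => ?_
    refine @decide_eq_true _ (_) fun hb => ?_
    have h := hL.precedes_of_path hH
      (StreamingRankedPairs.path_of_borders hn hΔ hH hP hτ hb)
    rcases hx with rfl | hx
    -- A bordering transaction comes strictly after `τ` in `L`, so it is neither `τ` nor before it.
    · exact h.ne hL.1 rfl
    · exact (h.trans hL.1 hx).ne hL.1 rfl
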